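/- Let $\mathcal E$ be the 4D Martínez Alonso–Shabat equation $u_{ty}=u_zu_{xy}-u_yu_{xz}$ (considered where $u_y\neq0$), with internal coordinates $x,y,z,t$ and $u_{x^az^b}$, $u_{x^az^by^k}$, $u_{x^az^bt^l}$ ($a,b\ge0$, $k,l\ge1$). Let $\tau^\pm=\tau^-\oplus\tau^+$ be the covering $\mathcal E^-\times_{\mathcal E}\mathcal E^+\to\mathcal E$ with nonlocal variables $r_i,q_i$ ($i\ge1$) and all $r_i^{\alpha,\beta}=\partial_y^\alpha\partial_z^\beta r_i$, $q_i^{\alpha,\beta}=\partial_x^\alpha\partial_t^\beta q_i$, subject to $$r_{i,t}=\tfrac{u_z}{u_y}r_{i-1,y}-r_{i-1,z},\quad r_{i,x}=\tfrac1{u_y}r_{i-1,y},\qquad q_{i,y}=u_yq_{i-1,x},\quad q_{i,z}=u_zq_{i-1,x}-q_{i-1,t}\qquad(i\ge1),$$ where $r_0=y$, $q_{-1}=x$, $q_0=u$; let $D_x,D_y,D_z,D_t$ be the corresponding total derivatives. Functions are smooth functions of finitely many coordinates. A nonlocal symmetry in $\tau^\pm$ is a vector field on $\mathcal E^-\times_{\mathcal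 E}\mathcal E^+$ that is vertical over the space of $(x,y,z,t)$ and whose commutators with the total derivatives lie in their span. A shadow is a function $\phi$ with $$D_yD_t\phi=u_{xy}D_z\phi-u_{xz}D_y\phi+u_zD_xD_y\phi-u_yD_xD_z\phi ;$$ a nonlocal symmetry $S$ is a lift of $\phi$ if its coefficients at $\partial/\partial u_{x^az^b}$, $\partial/\partial u_{x^az^by^k}$, $\partial/\partial u_{x^az^bt^l}$ are $D_x^aD_z^b\phi$, $D_x^aD_z^bD_y^k\phi$, $D_x^aD_z^bD_t^l\phi$. For functions $\phi,\phi^-_\alpha,\phi^+_\alpha$ ($\alpha\ge1$) let $[\phi;\phi^-_\alpha;\phi^+_\alpha]$ denote the vertical vector field whose coefficients at the coordinates on $\mathcal E$ are as above and whose coefficients at $\partial/\partial r_i^{\alpha,\beta}$, $\partial/\partial q_i^{\alpha,\beta}$ are $D_y^\alpha D_z^\beta\phi^-_i$, $D_x^\alpha D_t^\beta\phi^+_i$. Put $$\begin{aligned} \Psi^0_{-1}&=[-u_z;\ -r_{\alpha,z};\ -q_{\alpha,z}],\qquad \Psi^0_0=[u_t;\ r_{\alpha,t};\ q_{\alpha,t}],\\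 \Psi^0_1&=[q_{1,t}-u_tu_x;\ r_{\alpha-1,t}-u_tr_{\alpha,x};\ q_{\alpha+1,t}-u_tq_{\alpha,x}],\\ \Omega_{-1}&=[u_y(r_1+zr_{1,z});\ -(\alpha+1)r_{\alpha+1}-zr_{\alpha+1,z}+(r_1+zr_{1,z})r_{\alpha,y};\\ &\qquad zq_{\alpha-2,t}-zu_zq_{\alpha-2,x}+\alpha q_{\alpha-1}+u_y(r_1+zr_{1,z})q_{\alpha-1,x}],\\ \Omega_1&=[2q_1-uu_x+zu_t;\ -(\alpha-1)r_{\alpha-1}-zr_{\alpha-1,z}+(zr_{1,t}-ur_{1,x})r_{\alpha-1,y};\\ &\qquad(\alpha+2)q_{\alpha+1}-uq_{\alpha,x}+zq_{\alpha,t}], \end{aligned}$$ and, with $[\cdot,\cdot]$ the commutator of vector fields, $$\Psi^0_i=\tfrac1{i-1}[\Omega_1,\Psi^0_{i-1}]\ \ (i\ge2),\qquad \Psi^0_i=\tfrac1{i+1}[\Omega_{-1},\Psi^0_{i+1}]\ \ (i\le-2).$$ Let $\psi^0_{i,0}$ be the coefficient of $\Psi^0_i$ at $\partial/\partial u$ and,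 for $j\ge0$ and $i\in\mathbb Z$, $$\psi^j_{i,0}=\sum_{m=0}^j(-1)^m\binom jm t^{j-m}z^m\psi^0_{i-m,0}.$$ Theorem. For all $i\in\mathbb Z$ and $j\ge0$ the function $\psi^j_{i,0}$ is a shadow, and it has a lift $\Psi^j_i$ to a nonlocal symmetry in $\tau^\pm$ (for $j=0$ one may take the field $\Psi_i^0$ above). This gives infinitely many hierarchies $\{\Psi^j_i\}_{i\in\mathbb Z}$, $j=0,1,2,\dots$: for $j\neq j'$ the families $\{\psi^j_{i,0}\}_{i\in\mathbb Z}$ and $\{\psi^{j'}_{i,0}\}_{i\in\mathbb Z}$ are different. -/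

import Mathlib

open scoped ContDiff

namespace MASh

noncomputable section

/-! ## Coordinates and functions on the Whitney product of the two coverings -/

/-- The coordinates on `E⁻ ×_E E⁺`, where `E` is the equation
`u_ty = u_z u_xy - u_y u_xz`:
* `x`, `y`, `z`, `t`: the independent variables;
* `u i j` is `u_{x^i z^j}`, `uy i j k` is `u_{x^i z^j y^(k+1)}`, `ut i j l` is `u_{x^i z^j t^(l+1)}`:
  the internal coordinates on `E`;
* `r n a b` is the nonlocal variable `r_{n+1}^{a,b}` of `τ⁻` (the `y^a z^b` derivative of
  `r_{n+1}`);
* `q n a b` is the nonlocal variable `q_{n+1}^{a,b}` of `τ⁺` (the `x^a t^b` derivative of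
  `q_{n+1}`). -/
inductive Coord : Type
  | x | y | z | t
  | u (i j : ℕ)
  | uy (i j k : ℕ)
  | ut (i j l : ℕ)
  | r (n a b : ℕ)
  | q (n a b : ℕ)
  deriving DecidableEq

/-- Points of the coordinate space. -/
abbrev Pt : Type := Coord → ℝ

/-- The manifold `E⁻ ×_E E⁺`: the domain `u_y ≠ 0` of the coordinate space (the equations of `τ⁻`
involve `u_y⁻¹`). -/
def domain : Set Pt := {p | p (.uy 0 0 0) ≠ 0}

/-- Real functions of the coordinates. Only their values on `domain` are meaningful. -/
abbrev Fn : Type := Pt → ℝ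

/-- Equality of functions on the manifold. -/
def SameOn (f g : Fn) : Prop := ∀ p ∈ domain, f p = g p

/-- Smooth functions on the manifold: on `domain`, the function is a smooth function of finitely
many coordinates. -/
def IsSmooth (f : Fn) : Prop :=
  ∃ (s : Finset Coord) (g : (s → ℝ) → ℝ),
    ContDiffOn ℝ ∞ g {v | ∀ h : Coord.uy 0 0 0 ∈ s, v ⟨Coord.uy 0 0 0, h⟩ ≠ 0} ∧
    ∀ p ∈ domain, f p = g (fun c => p c)

/-- A coordinate, as a function. -/
def co (c : Coord) : Fn := fun p => p c

/-- The partial derivative of `f` with respect to the coordinate `c`. -/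
def pd (c : Coord) (f : Fn) : Fn := fun p => deriv (fun s : ℝ => f (Function.update p c s)) (p c)

/-- A vector field `∑ X_c ∂/∂c`, given by its (possibly infinitely many) coefficients. -/
abbrev VField : Type := Coord → Fn

/-- The action `X(f) = ∑ X_c ∂f/∂c` of a vector field on a function (a finite sum when `f` depends
on finitely many coordinates). -/
def act (X : VField) (f : Fn) : Fn := fun p => ∑ᶠ c : Coord, X c p * pd c f p

/-- The commutator of vector fields. -/
def comm (X Y : VField) : VField := fun c => act X (Y c) - act Y (X c)

/-! ## Total derivatives -/

/-- `u_x` -/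
def ux : Fn := co (.u 1 0)
/-- `u_y` -/
def uy : Fn := co (.uy 0 0 0)
/-- `u_z` -/
def uz : Fn := co (.u 0 1)
/-- `u_t` -/
def ut : Fn := co (.ut 0 0 0)
/-- `u_xy` -/
def uxy : Fn := co (.uy 1 0 0)
/-- `u_xz` -/
def uxz : Fn := co (.u 1 1)

/-- The right-hand side `u_z u_xy - u_y u_xz` of the equation. -/
def rhs : Fn := uz * uxy - uy * uxz

/-- `r_i` for `i ≥ 0`, with `r_0 = y` (and `0` for negative `i`). -/
def r : ℤ → Fn
  | .ofNat 0 => co .y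
  | .ofNat (n + 1) => co (.r n 0 0)
  | .negSucc _ => 0

/-- `q_i` for `i ≥ -1`, with `q_{-1} = x` and `q_0 = u` (and `0` for `i < -1`). -/
def q : ℤ → Fn
  | .ofNat 0 => co (.u 0 0)
  | .ofNat (n + 1) => co (.q n 0 0)
  | .negSucc 0 => co .x
  | .negSucc (_ + 1) => 0

/-- The restriction of the total derivative in `y` to functions of `x, y, z, t`,
`u_{x^i z^j}`, `u_{x^i z^j y^k}` and `r_i^{a,b}`, on which it just shifts indices. The coefficients
of the other coordinates are set to `0` and play no role below. -/
def DyShift : VField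
  | .y => 1
  | .u i j => co (.uy i j 0)
  | .uy i j k => co (.uy i j (k + 1))
  | .r n a b => co (.r n (a + 1) b)
  | _ => 0

/-- The restriction of the total derivative in `z` to functions of `x, y, z, t`, the local
coordinates and `r_i^{a,b}`, on which it just shifts indices. The coefficients of the other
coordinates are set to `0` and play no role below. -/
def DzShift : VField
  | .z => 1
  | .u i j => co (.u i (j + 1))
  | .uy i j k => co (.uy i (j + 1) k)
  | .ut i j l => co (.ut i (j + 1) l)
  | .r n a b => co (.r n a (b + 1))
  | _ => 0

/-- The total derivative `D_x` in `τ^±`: `r_{i,x} = u_y⁻¹ r_{i-1,y}`. -/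
def Dx : VField
  | .x => 1
  | .y => 0
  | .z => 0
  | .t => 0
  | .u i j => co (.u (i + 1) j)
  | .uy i j k => co (.uy (i + 1) j k)
  | .ut i j l => co (.ut (i + 1) j l)
  | .r n a b => (act DyShift)^[a] ((act DzShift)^[b] (uy⁻¹ * act DyShift (r n)))
  | .q n a b => co (.q n (a + 1) b)

/-- The total derivative `D_t` in `τ^±`: `u_ty = u_z u_xy - u_y u_xz` and
`r_{i,t} = u_z u_y⁻¹ r_{i-1,y} - r_{i-1,z}`. -/
def Dt : VField
  | .x => 0
  | .y => 0
  | .z => 0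
  | .t => 1
  | .u i j => co (.ut i j 0)
  | .uy i j k => (act Dx)^[i] ((act DzShift)^[j] ((act DyShift)^[k] rhs))
  | .ut i j l => co (.ut i j (l + 1))
  | .r n a b => (act DyShift)^[a] ((act DzShift)^[b]
      (uz * uy⁻¹ * act DyShift (r n) - act DzShift (r n)))
  | .q n a b => co (.q n a (b + 1))

/-- The total derivative `D_y` in `τ^±`: `u_ty = u_z u_xy - u_y u_xz` and
`q_{i,y} = u_y q_{i-1,x}`. -/
def Dy : VField
  | .x => 0
  | .y => 1
  | .z => 0
  | .t => 0
  | .u i j => co (.uy i j 0)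
  | .uy i j k => co (.uy i j (k + 1))
  | .ut i j l => (act Dx)^[i] ((act DzShift)^[j] ((act Dt)^[l] rhs))
  | .r n a b => co (.r n (a + 1) b)
  | .q n a b => (act Dx)^[a] ((act Dt)^[b] (uy * act Dx (q n)))

/-- The total derivative `D_z` in `τ^±`: `q_{i,z} = u_z q_{i-1,x} - q_{i-1,t}`. -/
def Dz : VField
  | .x => 0
  | .y => 0
  | .z => 1
  | .t => 0
  | .u i j => co (.u i (j + 1))
  | .uy i j k => co (.uy i (j + 1) k)
  | .ut i j l => co (.ut i (j + 1) l)
  | .r n a b => co (.r n a (b + 1))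
  | .q n a b => (act Dx)^[a] ((act Dt)^[b] (uz * act Dx (q n) - act Dt (q n)))

/-! ## Shadows and nonlocal symmetries -/

/-- The linearization of the equation, lifted to `τ^±`. -/
def ell (φ : Fn) : Fn :=
  act Dy (act Dt φ) - uxy * act Dz φ + uxz * act Dy φ - uz * act Dx (act Dy φ)
    + uy * act Dx (act Dz φ)

/-- `φ` is (the generating function of) a shadow of a symmetry in `τ^±`. -/
def IsShadow (φ : Fn) : Prop := IsSmooth φ ∧ SameOn (ell φ) 0

/-- The vertical field with generating functions `φ` (at `∂/∂u`), `φm i` (at `∂/∂r_i`, `i ≥ 1`) and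
`φp i` (at `∂/∂q_i`, `i ≥ 1`). -/
def field (φ : Fn) (φm φp : ℤ → Fn) : VField
  | .x => 0
  | .y => 0
  | .z => 0
  | .t => 0
  | .u i j => (act Dx)^[i] ((act Dz)^[j] φ)
  | .uy i j k => (act Dx)^[i] ((act Dz)^[j] ((act Dy)^[k + 1] φ))
  | .ut i j l => (act Dx)^[i] ((act Dz)^[j] ((act Dt)^[l + 1] φ))
  | .r n a b => (act Dy)^[a] ((act Dz)^[b] (φm (n + 1)))
  | .q n a b => (act Dx)^[a] ((act Dt)^[b] (φp (n + 1)))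

/-- The evolutionary field `E_φ^±`, a derivation from functions on `E` to functions on
`E⁻ ×_E E⁺`: it has no components along the nonlocal variables. -/
def evol (φ : Fn) : VField := field φ 0 0

/-- The coordinates on `E` itself. -/
def IsLocal : Coord → Prop
  | .r _ _ _ => False
  | .q _ _ _ => False
  | _ => True

/-- A `τ^±`-nonlocal symmetry: a smooth vertical vector field on `E⁻ ×_E E⁺` whose commutators with
the total derivatives lie in the Cartan distribution, the span of the total derivatives. -/
structure IsSymmetry (S : VField) : Prop where
  smooth : ∀ c, IsSmooth (S c)
  vert_x : SameOn (S .x) 0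
  vert_y : SameOn (S .y) 0
  vert_z : SameOn (S .z) 0
  vert_t : SameOn (S .t) 0
  cartan : ∀ D ∈ ({Dx, Dy, Dz, Dt} : Set VField), ∃ a₁ a₂ a₃ a₄ : Fn, ∀ c,
    SameOn (comm S D c) (a₁ * Dx c + a₂ * Dy c + a₃ * Dz c + a₄ * Dt c)

/-- The nonlocal symmetry `S` is a lift to `τ^±` of the shadow `φ`: its restriction to functions on
`E` is `E_φ^±`. -/
def IsLift (S : VField) (φ : Fn) : Prop :=
  IsSymmetry S ∧ ∀ c, IsLocal c → SameOn (S c) (evol φ c)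

/-! ## The seed symmetries -/

/-- The symmetry `Ψ_{-1}^0` -/
def PsiM1 : VField :=
  field (-uz) (fun α => -act Dz (r α)) (fun α => -act Dz (q α))

/-- The symmetry `Ψ_0^0` -/
def PsiZero : VField :=
  field ut (fun α => act Dt (r α)) (fun α => act Dt (q α))

/-- The symmetry `Ψ_1^0` -/
def PsiOne : VField :=
  field (act Dt (q 1) - ut * ux)
    (fun α => act Dt (r (α - 1)) - ut * act Dx (r α))
    (fun α => act Dt (q (α + 1)) - ut * act Dx (q α))

/-- The symmetry `Ω_{-1}^0` -/
def OmegaM1 : VField :=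
  field (uy * (r 1 + co .z * act Dz (r 1)))
    (fun α => -((α : ℝ) + 1) • r (α + 1) - co .z * act Dz (r (α + 1))
      + (r 1 + co .z * act Dz (r 1)) * act Dy (r α))
    (fun α => co .z * act Dt (q (α - 2)) - co .z * uz * act Dx (q (α - 2))
      + (α : ℝ) • q (α - 1)
      + uy * (r 1 + co .z * act Dz (r 1)) * act Dx (q (α - 1)))

/-- The symmetry `Ω_1^0` -/
def OmegaOne : VField :=
  field ((2 : ℝ) • q 1 - q 0 * ux + co .z * ut)
    (fun α => -((α : ℝ) - 1) • r (α - 1) - co .z * act Dz (r (α - 1))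
      + (co .z * act Dt (r 1) - q 0 * act Dx (r 1)) * act Dy (r (α - 1)))
    (fun α => ((α : ℝ) + 2) • q (α + 1) - q 0 * act Dx (q α) + co .z * act Dt (q α))

/-! ## The hierarchies -/

/-- `PsiPos n` is `Ψ_{n+1}^0`: `Ψ_i^0 = (i - 1)⁻¹ {Ω_1^0, Ψ_{i-1}^0}` for `i ≥ 2`. -/
def PsiPos : ℕ → VField
  | 0 => PsiOne
  | n + 1 => ((n : ℝ) + 1)⁻¹ • comm OmegaOne (PsiPos n)

/-- `PsiNeg n` is `Ψ_{-(n+1)}^0`: `Ψ_i^0 = (i + 1)⁻¹ {Ω_{-1}^0, Ψ_{i+1}^0}` for `i ≤ -2`. -/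
def PsiNeg : ℕ → VField
  | 0 => PsiM1
  | n + 1 => (-((n : ℝ) + 1))⁻¹ • comm OmegaM1 (PsiNeg n)

/-- The symmetries `Ψ_i^0`, `i ∈ ℤ`. -/
def Psi0 : ℤ → VField
  | .ofNat 0 => PsiZero
  | .ofNat (n + 1) => PsiPos n
  | .negSucc n => PsiNeg n

/-- The function `ψ_{i,0}^j = ∑_{m=0}^j (-1)^m (j choose m) t^(j-m) z^m ψ_{i-m,0}^0`, where
`ψ_{i,0}^0` is the coefficient of `Ψ_i^0` at `∂/∂u`. -/
def psi (j : ℕ) (i : ℤ) : Fn :=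
  ∑ m ∈ Finset.range (j + 1),
    ((-1 : ℝ) ^ m * (j.choose m : ℝ)) •
      (co .t ^ (j - m) * co .z ^ m * Psi0 (i - m) (.u 0 0))

end

end MASh

namespace MASh

noncomputable section

/-! ## The algebra of functions polynomial in the coordinates and `u_y⁻¹` -/

/-- The coordinate functions on the manifold. -/
def coordFn (c : Coord) : domain → ℝ := fun p => p.1 c

/-- The function `u_y⁻¹` on the manifold. -/
def uyInvFn : domain → ℝ := fun p => (p.1 (.uy 0 0 0))⁻¹

/-- Functions polynomial in the coordinates and `u_y⁻¹`. -/
def polySubalgebra : Subalgebra ℝ (domain → ℝ) :=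
  Algebra.adjoin ℝ (insert uyInvFn (Set.range coordFn))

/-- `polySubalgebra`, as a type. -/
def Alg : Type := polySubalgebra

instance : CommRing Alg := inferInstanceAs (CommRing polySubalgebra)
instance : Algebra ℝ Alg := inferInstanceAs (Algebra ℝ polySubalgebra)

namespace Alg

/-- The underlying function on the manifold. -/
def eval : Alg →ₐ[ℝ] (domain → ℝ) := polySubalgebra.val

theorem eval_injective : Function.Injective eval := Subtype.val_injective

/-- A coordinate, as an element of `Alg`. -/
def X (c : Coord) : Alg :=
  ⟨coordFn c, Algebra.subset_adjoin (Set.mem_insert_of_mem _ ⟨c, rfl⟩)⟩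

/-- The element `u_y⁻¹` of `Alg`. -/
def uyInv : Alg := ⟨uyInvFn, Algebra.subset_adjoin (Set.mem_insert _ _)⟩

@[simp] theorem eval_X (c : Coord) (p : domain) : eval (X c) p = p.1 c := rfl

@[simp] theorem eval_uyInv (p : domain) : eval uyInv p = (p.1 (.uy 0 0 0))⁻¹ := rfl

theorem uy_mul_uyInv : X (.uy 0 0 0) * uyInv = 1 := by
  apply eval_injective
  funext p
  have hp : p.1 (.uy 0 0 0) ≠ 0 := p.2
  simp [hp]

theorem induction {P : Alg → Prop} (hc : ∀ r : ℝ, P (algebraMap ℝ Alg r)) (hX : ∀ c, P (X c))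
    (hi : P uyInv) (ha : ∀ a b, P a → P b → P (a + b)) (hm : ∀ a b, P a → P b → P (a * b))
    (a : Alg) : P a := by
  obtain ⟨f, hf⟩ := a
  refine Algebra.adjoin_induction (p := fun f hf => P ⟨f, hf⟩) ?_ ?_ ?_ ?_ hf
  · rintro f (rfl | ⟨c, rfl⟩)
    · exact hi
    · exact hX c
  · exact fun r => hc r
  · exact fun f g hf hg h1 h2 => ha ⟨f, hf⟩ ⟨g, hg⟩ h1 h2
  · exact fun f g hf hg h1 h2 => hm ⟨f, hf⟩ ⟨g, hg⟩ h1 h2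

/-- Extension by zero to the whole coordinate space. -/
def ext0 (a : Alg) : Fn := by
  classical exact fun p => if h : p ∈ domain then eval a ⟨p, h⟩ else 0

theorem ext0_apply (a : Alg) (p : domain) : ext0 a p.1 = eval a p := by
  simp [ext0]

end Alg

open Alg

theorem eventually_update_mem (p : domain) (c : Coord) :
    ∀ᶠ s in nhds (p.1 c), Function.update p.1 c s ∈ domain := by
  have hcont : Continuous fun s : ℝ => Function.update p.1 c s (.uy 0 0 0) :=
    (continuous_apply (A := fun _ => ℝ) (Coord.uy 0 0 0)).comp
      ((continuous_const (y := p.1)).update c continuous_id)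
  refine hcont.continuousAt.eventually_ne ?_
  rw [Function.update_eq_self]
  exact p.2

/-- `b` is the gradient of `a`. -/
def HasGrad (a : Alg) (b : Coord →₀ Alg) : Prop :=
  ∀ (c : Coord) (p : domain),
    HasDerivAt (fun s => ext0 a (Function.update p.1 c s)) (eval (b c) p) (p.1 c)

theorem HasGrad.of_eq {a : Alg} {b : Coord →₀ Alg} (f : Fn)
    (hf : ∀ p : domain, f p.1 = eval a p)
    (h : ∀ (c : Coord) (p : domain),
      HasDerivAt (fun s => f (Function.update p.1 c s)) (eval (b c) p) (p.1 c)) :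
    HasGrad a b := by
  intro c p
  refine (h c p).congr_of_eventuallyEq ?_
  filter_upwards [eventually_update_mem p c] with s hs
  rw [ext0_apply a ⟨_, hs⟩, hf ⟨_, hs⟩]

theorem HasGrad.const (r : ℝ) : HasGrad (algebraMap ℝ Alg r) 0 := by
  refine HasGrad.of_eq (fun _ => r) (fun p => ?_) (fun c p => ?_)
  · rw [AlgHom.commutes]; rfl
  · simpa using hasDerivAt_const (p.1 c) r

theorem HasGrad.X (c : Coord) : HasGrad (Alg.X c) (Finsupp.single c 1) := by
  classical
  refine HasGrad.of_eq (fun p => p c) (fun p => rfl) (fun c' p => ?_)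
  by_cases h : c = c'
  · subst h
    simpa using hasDerivAt_id' (p.1 c)
  · simpa [Finsupp.single_apply, h, Function.update_of_ne h] using
      hasDerivAt_const (p.1 c') (p.1 c)

theorem HasGrad.uyInv :
    HasGrad Alg.uyInv (Finsupp.single (.uy 0 0 0) (-(Alg.uyInv * Alg.uyInv))) := by
  classical
  refine HasGrad.of_eq (fun p => (p (.uy 0 0 0))⁻¹) (fun p => rfl) (fun c' p => ?_)
  have hp : p.1 (.uy 0 0 0) ≠ 0 := p.2
  by_cases h : Coord.uy 0 0 0 = c'
  · subst h
    have := hasDerivAt_inv hp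
    simp only [Function.update_self, Finsupp.single_eq_same, map_neg, map_mul, Pi.neg_apply,
      Pi.mul_apply, eval_uyInv]
    refine this.congr_deriv ?_
    rw [pow_two, mul_inv]
  · simpa [Finsupp.single_apply, h, Function.update_of_ne h] using
      hasDerivAt_const (p.1 c') (p.1 (.uy 0 0 0))⁻¹

theorem HasGrad.add {a a' : Alg} {b b' : Coord →₀ Alg} (h : HasGrad a b) (h' : HasGrad a' b') :
    HasGrad (a + a') (b + b') := by
  refine HasGrad.of_eq (fun p => ext0 a p + ext0 a' p) (fun p => ?_) (fun c p => ?_)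
  · simp [ext0_apply]
  · exact (h c p).fun_add (h' c p)

theorem HasGrad.mul {a a' : Alg} {b b' : Coord →₀ Alg} (h : HasGrad a b) (h' : HasGrad a' b') :
    HasGrad (a * a') (a • b' + a' • b) := by
  refine HasGrad.of_eq (fun p => ext0 a p * ext0 a' p) (fun p => ?_) (fun c p => ?_)
  · simp [ext0_apply]
  · have := (h c p).fun_mul (h' c p)
    simp only [Function.update_eq_self, ext0_apply] at this
    refine this.congr_deriv ?_
    simp only [Finsupp.coe_add, Finsupp.coe_smul, Pi.add_apply, Pi.smul_apply, smul_eq_mul, map_add,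
      map_mul, Pi.mul_apply]
    ring

theorem HasGrad.unique {a : Alg} {b b' : Coord →₀ Alg} (h : HasGrad a b) (h' : HasGrad a b') :
    b = b' := by
  ext c
  apply eval_injective
  funext p
  exact (h c p).unique (h' c p)

theorem exists_hasGrad (a : Alg) : ∃ b, HasGrad a b := by
  induction a using Alg.induction with
  | hc r => exact ⟨_, HasGrad.const r⟩
  | hX c => exact ⟨_, HasGrad.X c⟩
  | hi => exact ⟨_, HasGrad.uyInv⟩
  | ha a b h1 h2 => exact ⟨_, h1.choose_spec.add h2.choose_spec⟩
  | hm a b h1 h2 => exact ⟨_, h1.choose_spec.mul h2.choose_spec⟩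

theorem hasGrad_choose (a : Alg) : HasGrad a (exists_hasGrad a).choose :=
  (exists_hasGrad a).choose_spec

/-- The gradient, as a derivation. -/
def grad : Derivation ℝ Alg (Coord →₀ Alg) :=
  Derivation.mk'
    { toFun := fun a => (exists_hasGrad a).choose
      map_add' := fun a b =>
        (hasGrad_choose (a + b)).unique ((hasGrad_choose a).add (hasGrad_choose b))
      map_smul' := fun r a => by
        have h := (HasGrad.const r).mul (hasGrad_choose a)
        rw [← Algebra.smul_def, smul_zero, add_zero] at h
        rw [(hasGrad_choose (r • a)).unique h, algebraMap_smul]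
        rfl }
    (fun a b => (hasGrad_choose (a * b)).unique ((hasGrad_choose a).mul (hasGrad_choose b)))

theorem hasGrad_grad (a : Alg) : HasGrad a (grad a) := hasGrad_choose a

theorem grad_X (c : Coord) : grad (X c) = Finsupp.single c 1 :=
  (hasGrad_grad _).unique (HasGrad.X c)

/-- The derivation with prescribed values at the coordinates. -/
def der (ξ : Coord → Alg) : Derivation ℝ Alg Alg :=
  (Finsupp.linearCombination Alg ξ).compDer grad

@[simp] theorem der_X (ξ : Coord → Alg) (c : Coord) : der ξ (X c) = ξ c := by
  change Finsupp.linearCombination Alg ξ (grad (X c)) = ξ c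
  simp [grad_X]

theorem derivation_uyInv (D : Derivation ℝ Alg Alg) :
    D uyInv = -(uyInv * uyInv * D (X (.uy 0 0 0))) := by
  have h := congrArg D uy_mul_uyInv
  rw [D.leibniz, D.map_one_eq_zero] at h
  simp only [smul_eq_mul] at h
  linear_combination uyInv * h - D uyInv * uy_mul_uyInv

theorem derivation_ext {D D' : Derivation ℝ Alg Alg} (h : ∀ c, D (X c) = D' (X c)) : D = D' := by
  ext a
  induction a using Alg.induction with
  | hc r => simp
  | hX c => exact h c
  | hi => rw [derivation_uyInv, derivation_uyInv, h]
  | ha a b h1 h2 => rw [map_add, map_add, h1, h2]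
  | hm a b h1 h2 => rw [D.leibniz, D'.leibniz, h1, h2]

/-! ## Functions represented in the algebra -/

/-- On the manifold, `f` is the element `a` of `Alg`. -/
def Rep (f : Fn) (a : Alg) : Prop := ∀ p : domain, f p.1 = eval a p

namespace Rep

theorem sameOn {f g : Fn} {a b : Alg} (hf : Rep f a) (hg : Rep g b) (h : a = b) : SameOn f g := by
  subst h
  exact fun p hp => (hf ⟨p, hp⟩).trans (hg ⟨p, hp⟩).symm

theorem co (c : Coord) : Rep (MASh.co c) (X c) := fun _ => rfl

theorem zero : Rep 0 0 := fun p => by simp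

theorem one : Rep 1 1 := fun p => by simp

theorem uy_inv : Rep uy⁻¹ uyInv := fun _ => rfl

theorem add {f g : Fn} {a b : Alg} (hf : Rep f a) (hg : Rep g b) : Rep (f + g) (a + b) :=
  fun p => by simp [hf p, hg p]

theorem sub {f g : Fn} {a b : Alg} (hf : Rep f a) (hg : Rep g b) : Rep (f - g) (a - b) :=
  fun p => by simp [hf p, hg p]

theorem neg {f : Fn} {a : Alg} (hf : Rep f a) : Rep (-f) (-a) :=
  fun p => by simp [hf p]

theorem mul {f g : Fn} {a b : Alg} (hf : Rep f a) (hg : Rep g b) : Rep (f * g) (a * b) :=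
  fun p => by simp [hf p, hg p]

theorem pow {f : Fn} {a : Alg} (hf : Rep f a) (n : ℕ) : Rep (f ^ n) (a ^ n) :=
  fun p => by simp [hf p]

theorem smul (r : ℝ) {f : Fn} {a : Alg} (hf : Rep f a) : Rep (r • f) (r • a) :=
  fun p => by simp [hf p]

theorem sum {ι : Type*} (s : Finset ι) {f : ι → Fn} {a : ι → Alg} (h : ∀ i, Rep (f i) (a i)) :
    Rep (∑ i ∈ s, f i) (∑ i ∈ s, a i) :=
  fun p => by
    rw [map_sum, Finset.sum_apply, Finset.sum_apply]
    exact Finset.sum_congr rfl fun i _ => h i p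

theorem pd {f : Fn} {a : Alg} (hf : Rep f a) (c : Coord) : Rep (pd c f) (grad a c) := by
  intro p
  refine HasDerivAt.deriv ((hasGrad_grad a c p).congr_of_eventuallyEq ?_)
  filter_upwards [eventually_update_mem p c] with s hs
  rw [ext0_apply a ⟨_, hs⟩, hf ⟨_, hs⟩]

theorem act {V : VField} {ξ : Coord → Alg} (hV : ∀ c, Rep (V c) (ξ c)) {f : Fn} {a : Alg}
    (hf : Rep f a) : Rep (act V f) (der ξ a) := by
  classical
  intro p
  have hder : der ξ a = ∑ c ∈ (grad a).support, grad a c * ξ c := by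
    change Finsupp.linearCombination Alg ξ (grad a) = _
    simp [Finsupp.linearCombination_apply, Finsupp.sum]
  have hterm : (fun c => V c p.1 * MASh.pd c f p.1) = fun c => eval (grad a c * ξ c) p := by
    funext c
    rw [hV c p, hf.pd c p]
    simp [mul_comm]
  rw [MASh.act, hterm, finsum_eq_sum_of_support_subset (s := (grad a).support), hder]
  · simp
  · intro c hc
    simp only [Function.mem_support, ne_eq] at hc
    simp only [Finset.mem_coe, Finsupp.mem_support_iff]
    rintro h
    simp [h] at hc

theorem iterate {V : VField} {ξ : Coord → Alg} (hV : ∀ c, Rep (V c) (ξ c)) {f : Fn} {a : Alg}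
    (hf : Rep f a) (n : ℕ) : Rep ((MASh.act V)^[n] f) ((der ξ)^[n] a) := by
  induction n with
  | zero => exact hf
  | succ n ih =>
    rw [Function.iterate_succ_apply', Function.iterate_succ_apply']
    exact act hV ih

/-! ### Smoothness -/

theorem exists_smooth_extend {f : Fn} {s s' : Finset Coord} (hs : s ⊆ s') {g : (s → ℝ) → ℝ}
    (hg : ContDiffOn ℝ ∞ g {v | ∀ h : Coord.uy 0 0 0 ∈ s, v ⟨Coord.uy 0 0 0, h⟩ ≠ 0})
    (hf : ∀ p ∈ domain, f p = g (fun c => p c)) :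
    ∃ g' : (s' → ℝ) → ℝ,
      ContDiffOn ℝ ∞ g' {v | ∀ h : Coord.uy 0 0 0 ∈ s', v ⟨Coord.uy 0 0 0, h⟩ ≠ 0} ∧
      ∀ p ∈ domain, f p = g' (fun c => p c) := by
  refine ⟨fun v => g fun c => v ⟨c.1, hs c.2⟩, ?_, fun p hp => hf p hp⟩
  refine hg.comp (t := {v | ∀ h : Coord.uy 0 0 0 ∈ s, v ⟨Coord.uy 0 0 0, h⟩ ≠ 0}) ?_ ?_
  · exact (contDiff_pi.2 fun c => contDiff_apply ℝ ℝ _).contDiffOn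
  · exact fun v hv h => hv (hs h)

theorem isSmooth_binary {f f' : Fn} (op : ℝ → ℝ → ℝ)
    (hop : ContDiff ℝ ∞ fun w : ℝ × ℝ => op w.1 w.2)
    (hf : IsSmooth f) (hf' : IsSmooth f') : IsSmooth fun p => op (f p) (f' p) := by
  classical
  obtain ⟨s, g, hg, h⟩ := hf
  obtain ⟨s', g', hg', h'⟩ := hf'
  obtain ⟨k, hk, e⟩ := exists_smooth_extend (Finset.subset_union_left (s₂ := s')) hg h
  obtain ⟨k', hk', e'⟩ := exists_smooth_extend (Finset.subset_union_right (s₁ := s)) hg' h'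
  refine ⟨s ∪ s', fun v => op (k v) (k' v), hop.comp_contDiffOn (hk.prodMk hk'), fun p hp => ?_⟩
  simp only [e p hp, e' p hp]

theorem isSmooth_ext0 (a : Alg) : IsSmooth (ext0 a) := by
  induction a using Alg.induction with
  | hc r =>
    refine ⟨∅, fun _ => r, contDiffOn_const, fun p hp => ?_⟩
    rw [ext0_apply _ ⟨p, hp⟩, AlgHom.commutes]
    rfl
  | hX c =>
    refine ⟨{c}, fun v => v ⟨c, Finset.mem_singleton_self c⟩, (contDiff_apply ℝ ℝ _).contDiffOn,
      fun p hp => ?_⟩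
    rw [ext0_apply _ ⟨p, hp⟩, eval_X]
  | hi =>
    refine ⟨{.uy 0 0 0}, fun v => (v ⟨.uy 0 0 0, Finset.mem_singleton_self _⟩)⁻¹, ?_,
      fun p hp => ?_⟩
    · exact (contDiff_apply ℝ ℝ _).contDiffOn.inv fun v hv => hv (Finset.mem_singleton_self _)
    · rw [ext0_apply _ ⟨p, hp⟩, eval_uyInv]
  | ha a b h1 h2 =>
    obtain ⟨s, g, hg, h⟩ := isSmooth_binary (· + ·) (contDiff_fst.add contDiff_snd) h1 h2
    refine ⟨s, g, hg, fun p hp => ?_⟩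
    simp only [← h p hp, ext0_apply _ ⟨p, hp⟩, map_add, Pi.add_apply]
  | hm a b h1 h2 =>
    obtain ⟨s, g, hg, h⟩ := isSmooth_binary (· * ·) (contDiff_fst.mul contDiff_snd) h1 h2
    refine ⟨s, g, hg, fun p hp => ?_⟩
    simp only [← h p hp, ext0_apply _ ⟨p, hp⟩, map_mul, Pi.mul_apply]

theorem isSmooth {f : Fn} {a : Alg} (hf : Rep f a) : IsSmooth f := by
  obtain ⟨s, g, hg, h⟩ := isSmooth_ext0 a
  exact ⟨s, g, hg, fun p hp => by rw [← h p hp, ext0_apply _ ⟨p, hp⟩]; exact hf ⟨p, hp⟩⟩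

end Rep

/-! ## Total derivatives on the algebra -/

/-- `r_i`, as an element of the algebra. -/
def rA : ℤ → Alg
  | .ofNat 0 => X .y
  | .ofNat (n + 1) => X (.r n 0 0)
  | .negSucc _ => 0

/-- `q_i`, as an element of the algebra. -/
def qA : ℤ → Alg
  | .ofNat 0 => X (.u 0 0)
  | .ofNat (n + 1) => X (.q n 0 0)
  | .negSucc 0 => X .x
  | .negSucc (_ + 1) => 0

/-- The right-hand side of the equation, as an element of the algebra. -/
def rhsA : Alg := X (.u 0 1) * X (.uy 1 0 0) - X (.uy 0 0 0) * X (.u 1 1)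

/-- The coefficients of `DyShift`. -/
def yShift : Coord → Alg
  | .y => 1
  | .u i j => X (.uy i j 0)
  | .uy i j k => X (.uy i j (k + 1))
  | .r n a b => X (.r n (a + 1) b)
  | _ => 0

/-- The coefficients of `DzShift`. -/
def zShift : Coord → Alg
  | .z => 1
  | .u i j => X (.u i (j + 1))
  | .uy i j k => X (.uy i (j + 1) k)
  | .ut i j l => X (.ut i (j + 1) l)
  | .r n a b => X (.r n a (b + 1))
  | _ => 0

/-- The coefficients of `Dx`. -/
def xTot : Coord → Alg
  | .x => 1
  | .y => 0
  | .z => 0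
  | .t => 0
  | .u i j => X (.u (i + 1) j)
  | .uy i j k => X (.uy (i + 1) j k)
  | .ut i j l => X (.ut (i + 1) j l)
  | .r n a b => (der yShift)^[a] ((der zShift)^[b] (uyInv * der yShift (rA n)))
  | .q n a b => X (.q n (a + 1) b)

/-- The coefficients of `Dt`. -/
def tTot : Coord → Alg
  | .x => 0
  | .y => 0
  | .z => 0
  | .t => 1
  | .u i j => X (.ut i j 0)
  | .uy i j k => (der xTot)^[i] ((der zShift)^[j] ((der yShift)^[k] rhsA))
  | .ut i j l => X (.ut i j (l + 1))
  | .r n a b => (der yShift)^[a] ((der zShift)^[b]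
      (X (.u 0 1) * uyInv * der yShift (rA n) - der zShift (rA n)))
  | .q n a b => X (.q n a (b + 1))

/-- The coefficients of `Dy`. -/
def yTot : Coord → Alg
  | .x => 0
  | .y => 1
  | .z => 0
  | .t => 0
  | .u i j => X (.uy i j 0)
  | .uy i j k => X (.uy i j (k + 1))
  | .ut i j l => (der xTot)^[i] ((der zShift)^[j] ((der tTot)^[l] rhsA))
  | .r n a b => X (.r n (a + 1) b)
  | .q n a b => (der xTot)^[a] ((der tTot)^[b] (X (.uy 0 0 0) * der xTot (qA n)))

/-- The coefficients of `Dz`. -/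
def zTot : Coord → Alg
  | .x => 0
  | .y => 0
  | .z => 1
  | .t => 0
  | .u i j => X (.u i (j + 1))
  | .uy i j k => X (.uy i (j + 1) k)
  | .ut i j l => X (.ut i (j + 1) l)
  | .r n a b => X (.r n a (b + 1))
  | .q n a b => (der xTot)^[a] ((der tTot)^[b]
      (X (.u 0 1) * der xTot (qA n) - der tTot (qA n)))

/-- `D_x` on the algebra. -/
def dX : Derivation ℝ Alg Alg := der xTot
/-- `D_y` on the algebra. -/
def dY : Derivation ℝ Alg Alg := der yTot
/-- `D_z` on the algebra. -/
def dZ : Derivation ℝ Alg Alg := der zTot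
/-- `D_t` on the algebra. -/
def dT : Derivation ℝ Alg Alg := der tTot

theorem Rep.r (i : ℤ) : Rep (MASh.r i) (rA i) := by
  rcases i with (_ | n) | n
  · exact Rep.co _
  · exact Rep.co _
  · exact Rep.zero

theorem Rep.q (i : ℤ) : Rep (MASh.q i) (qA i) := by
  rcases i with (_ | n) | (_ | n)
  · exact Rep.co _
  · exact Rep.co _
  · exact Rep.co _
  · exact Rep.zero

theorem Rep.rhs : Rep MASh.rhs rhsA :=
  ((Rep.co _).mul (Rep.co _)).sub ((Rep.co _).mul (Rep.co _))

theorem rep_DyShift (c : Coord) : Rep (DyShift c) (yShift c) := by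
  cases c
  all_goals first | exact Rep.zero | exact Rep.one | exact Rep.co _

theorem rep_DzShift (c : Coord) : Rep (DzShift c) (zShift c) := by
  cases c
  all_goals first | exact Rep.zero | exact Rep.one | exact Rep.co _

theorem rep_Dx (c : Coord) : Rep (Dx c) (xTot c) := by
  cases c with
  | r n a b =>
    exact Rep.iterate rep_DyShift (Rep.iterate rep_DzShift
      (Rep.uy_inv.mul (Rep.act rep_DyShift (Rep.r n))) b) a
  | _ => first | exact Rep.zero | exact Rep.one | exact Rep.co _

theorem rep_Dt (c : Coord) : Rep (Dt c) (tTot c) := by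
  cases c with
  | r n a b =>
    exact Rep.iterate rep_DyShift (Rep.iterate rep_DzShift
      ((((Rep.co _).mul Rep.uy_inv).mul (Rep.act rep_DyShift (Rep.r n))).sub
        (Rep.act rep_DzShift (Rep.r n))) b) a
  | uy i j k =>
    exact Rep.iterate rep_Dx (Rep.iterate rep_DzShift (Rep.iterate rep_DyShift Rep.rhs k) j) i
  | _ => first | exact Rep.zero | exact Rep.one | exact Rep.co _

theorem rep_Dy (c : Coord) : Rep (Dy c) (yTot c) := by
  cases c with
  | q n a b =>
    exact Rep.iterate rep_Dx (Rep.iterate rep_Dt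
      ((Rep.co _).mul (Rep.act rep_Dx (Rep.q n))) b) a
  | ut i j l =>
    exact Rep.iterate rep_Dx (Rep.iterate rep_DzShift (Rep.iterate rep_Dt Rep.rhs l) j) i
  | _ => first | exact Rep.zero | exact Rep.one | exact Rep.co _

theorem rep_Dz (c : Coord) : Rep (Dz c) (zTot c) := by
  cases c with
  | q n a b =>
    exact Rep.iterate rep_Dx (Rep.iterate rep_Dt
      (((Rep.co _).mul (Rep.act rep_Dx (Rep.q n))).sub (Rep.act rep_Dt (Rep.q n))) b) a
  | _ => first | exact Rep.zero | exact Rep.one | exact Rep.co _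

/-! ### Subalgebras generated by some of the coordinates -/

/-- The subalgebra generated by `u_y⁻¹` and the coordinates satisfying `P`. -/
def coordSubalgebra (P : Coord → Prop) : Subalgebra ℝ Alg :=
  Algebra.adjoin ℝ (insert uyInv (X '' {c | P c}))

theorem X_mem {P : Coord → Prop} {c : Coord} (h : P c) : X c ∈ coordSubalgebra P :=
  Algebra.subset_adjoin (Set.mem_insert_of_mem _ ⟨c, h, rfl⟩)

theorem uyInv_mem {P : Coord → Prop} : uyInv ∈ coordSubalgebra P :=
  Algebra.subset_adjoin (Set.mem_insert _ _)

theorem coordSubalgebra_mono {P Q : Coord → Prop} (h : ∀ c, P c → Q c) {a : Alg}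
    (ha : a ∈ coordSubalgebra P) : a ∈ coordSubalgebra Q :=
  Algebra.adjoin_mono (Set.insert_subset_insert (Set.image_mono h)) ha

theorem derivation_eqOn {P : Coord → Prop} (hP : P (.uy 0 0 0)) {D D' : Derivation ℝ Alg Alg}
    (h : ∀ c, P c → D (X c) = D' (X c)) {a : Alg} (ha : a ∈ coordSubalgebra P) : D a = D' a := by
  refine Derivation.eqOn_adjoin (s := insert uyInv (X '' {c | P c})) ?_ ha
  rintro _ (rfl | ⟨c, hc, rfl⟩)
  · rw [derivation_uyInv, derivation_uyInv, h _ hP]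
  · exact h c hc

theorem derivation_mapsTo {P : Coord → Prop} (hP : P (.uy 0 0 0)) {D : Derivation ℝ Alg Alg}
    (h : ∀ c, P c → D (X c) ∈ coordSubalgebra P) {a : Alg} (ha : a ∈ coordSubalgebra P) :
    D a ∈ coordSubalgebra P := by
  induction ha using Algebra.adjoin_induction with
  | mem x hx =>
    rcases hx with rfl | ⟨c, hc, rfl⟩
    · rw [derivation_uyInv]
      exact neg_mem (mul_mem (mul_mem uyInv_mem uyInv_mem) (h _ hP))
    · exact h c hc
  | algebraMap r => rw [D.map_algebraMap]; exact zero_mem _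
  | add x y _ _ hx hy => rw [map_add]; exact add_mem hx hy
  | mul x y hx' hy' hx hy =>
    rw [D.leibniz]
    exact add_mem (mul_mem hx' hy) (mul_mem hy' hx)

theorem derivation_commOn {P : Coord → Prop} (hP : P (.uy 0 0 0)) {D D' : Derivation ℝ Alg Alg}
    (h : ∀ c, P c → D (D' (X c)) = D' (D (X c))) {a : Alg} (ha : a ∈ coordSubalgebra P) :
    D (D' a) = D' (D a) := by
  have := derivation_eqOn hP (D := ⁅D, D'⁆) (D' := 0)
    (fun c hc => by rw [Derivation.commutator_apply, h c hc, sub_self]; rfl) ha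
  rw [Derivation.commutator_apply] at this
  exact sub_eq_zero.1 this

theorem derivation_comm {D D' : Derivation ℝ Alg Alg}
    (h : ∀ c, D (D' (X c)) = D' (D (X c))) (a : Alg) : D (D' a) = D' (D a) := by
  have := DFunLike.congr_fun (derivation_ext (D := ⁅D, D'⁆) (D' := 0)
    (fun c => by rw [Derivation.commutator_apply, h c, sub_self]; rfl)) a
  rw [Derivation.commutator_apply] at this
  exact sub_eq_zero.1 this

theorem iterate_mem {S : Subalgebra ℝ Alg} {E : Alg → Alg} (hE : ∀ a ∈ S, E a ∈ S)
    {a : Alg} (ha : a ∈ S) (n : ℕ) : E^[n] a ∈ S := by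
  induction n with
  | zero => exact ha
  | succ n ih => rw [Function.iterate_succ_apply']; exact hE _ ih

theorem apply_iterate_of_mem {S : Subalgebra ℝ Alg} {D E : Alg → Alg} (hE : ∀ a ∈ S, E a ∈ S)
    (h : ∀ a ∈ S, D (E a) = E (D a)) {a : Alg} (ha : a ∈ S) (n : ℕ) :
    D (E^[n] a) = E^[n] (D a) := by
  induction n with
  | zero => rfl
  | succ n ih =>
    rw [Function.iterate_succ_apply', h _ (iterate_mem hE ha n), ih, ← Function.iterate_succ_apply' E]

theorem apply_iterate {D E : Alg → Alg} (h : ∀ a, D (E a) = E (D a)) (a : Alg) (n : ℕ) :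
    D (E^[n] a) = E^[n] (D a) :=
  apply_iterate_of_mem (S := ⊤) (fun _ _ => trivial) (fun a _ => h a) trivial n

theorem iterate_eq_of_mem {S : Subalgebra ℝ Alg} {D E : Alg → Alg} (hE : ∀ a ∈ S, E a ∈ S)
    (h : ∀ a ∈ S, D a = E a) {a : Alg} (ha : a ∈ S) (n : ℕ) : D^[n] a = E^[n] a := by
  induction n with
  | zero => rfl
  | succ n ih =>
    rw [Function.iterate_succ_apply', Function.iterate_succ_apply', ih, h _ (iterate_mem hE ha n)]

/-- The coordinates other than `u_{x^i z^j t^l}` and `q_i^{a,b}`. -/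
def IsYR : Coord → Prop
  | .ut _ _ _ => False
  | .q _ _ _ => False
  | _ => True

/-- The coordinates other than `q_i^{a,b}`. -/
def IsLocalOrR : Coord → Prop
  | .q _ _ _ => False
  | _ => True

/-- The subalgebra on which `DyShift` is `D_y`. -/
abbrev algYR : Subalgebra ℝ Alg := coordSubalgebra IsYR

/-- The subalgebra on which `DzShift` is `D_z`. -/
abbrev algLR : Subalgebra ℝ Alg := coordSubalgebra IsLocalOrR

theorem algYR_le {a : Alg} (ha : a ∈ algYR) : a ∈ algLR :=
  coordSubalgebra_mono (fun c => by cases c <;> simp [IsYR, IsLocalOrR]) ha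

theorem dY_eq_shift {a : Alg} (ha : a ∈ algYR) : dY a = der yShift a := by
  refine derivation_eqOn trivial (fun c hc => ?_) ha
  cases c <;> first | exact hc.elim | simp [dY, yTot, yShift]

theorem dZ_eq_shift {a : Alg} (ha : a ∈ algLR) : dZ a = der zShift a := by
  refine derivation_eqOn trivial (fun c hc => ?_) ha
  cases c <;> first | exact hc.elim | simp [dZ, zTot, zShift]

theorem dY_mem {a : Alg} (ha : a ∈ algYR) : dY a ∈ algYR := by
  refine derivation_mapsTo trivial (fun c hc => ?_) ha
  cases c <;> first | exact hc.elim | skip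
  all_goals
    simp only [dY, der_X, yTot]
    first | exact zero_mem _ | exact one_mem _ | exact X_mem trivial

theorem dZ_mem {a : Alg} (ha : a ∈ algYR) : dZ a ∈ algYR := by
  refine derivation_mapsTo trivial (fun c hc => ?_) ha
  cases c <;> first | exact hc.elim | skip
  all_goals
    simp only [dZ, der_X, zTot]
    first | exact zero_mem _ | exact one_mem _ | exact X_mem trivial

theorem dZ_mem' {a : Alg} (ha : a ∈ algLR) : dZ a ∈ algLR := by
  refine derivation_mapsTo trivial (fun c hc => ?_) ha
  cases c <;> first | exact hc.elim | skip
  all_goals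
    simp only [dZ, der_X, zTot]
    first | exact zero_mem _ | exact one_mem _ | exact X_mem trivial

theorem rA_mem (i : ℤ) : rA i ∈ algYR := by
  rcases i with (_ | n) | n
  · exact X_mem trivial
  · exact X_mem trivial
  · exact zero_mem _

theorem rhsA_mem : rhsA ∈ algYR :=
  sub_mem (mul_mem (X_mem trivial) (X_mem trivial)) (mul_mem (X_mem trivial) (X_mem trivial))

theorem iterate_yShift {a : Alg} (ha : a ∈ algYR) (n : ℕ) : (der yShift)^[n] a = dY^[n] a :=
  iterate_eq_of_mem (fun _ => dY_mem) (fun _ h => (dY_eq_shift h).symm) ha n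

theorem iterate_zShift {a : Alg} (ha : a ∈ algLR) (n : ℕ) : (der zShift)^[n] a = dZ^[n] a :=
  iterate_eq_of_mem (fun _ => dZ_mem') (fun _ h => (dZ_eq_shift h).symm) ha n

theorem iterate_dY_mem {a : Alg} (ha : a ∈ algYR) (n : ℕ) : dY^[n] a ∈ algYR :=
  iterate_mem (fun _ => dY_mem) ha n

theorem iterate_dZ_mem {a : Alg} (ha : a ∈ algYR) (n : ℕ) : dZ^[n] a ∈ algYR :=
  iterate_mem (fun _ => dZ_mem) ha n

/-! ### The total derivatives of the coordinates -/

theorem dX_u (i j : ℕ) : dX (X (.u i j)) = X (.u (i + 1) j) := der_X _ _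
theorem dX_uy (i j k : ℕ) : dX (X (.uy i j k)) = X (.uy (i + 1) j k) := der_X _ _
theorem dX_ut (i j l : ℕ) : dX (X (.ut i j l)) = X (.ut (i + 1) j l) := der_X _ _
theorem dX_q (n a b : ℕ) : dX (X (.q n a b)) = X (.q n (a + 1) b) := der_X _ _
theorem dX_x : dX (X .x) = 1 := der_X _ _
theorem dX_y : dX (X .y) = 0 := der_X _ _
theorem dX_z : dX (X .z) = 0 := der_X _ _
theorem dX_t : dX (X .t) = 0 := der_X _ _
theorem dY_u (i j : ℕ) : dY (X (.u i j)) = X (.uy i j 0) := der_X _ _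
theorem dY_uy (i j k : ℕ) : dY (X (.uy i j k)) = X (.uy i j (k + 1)) := der_X _ _
theorem dY_r (n a b : ℕ) : dY (X (.r n a b)) = X (.r n (a + 1) b) := der_X _ _
theorem dY_x : dY (X .x) = 0 := der_X _ _
theorem dY_y : dY (X .y) = 1 := der_X _ _
theorem dY_z : dY (X .z) = 0 := der_X _ _
theorem dY_t : dY (X .t) = 0 := der_X _ _
theorem dZ_u (i j : ℕ) : dZ (X (.u i j)) = X (.u i (j + 1)) := der_X _ _
theorem dZ_uy (i j k : ℕ) : dZ (X (.uy i j k)) = X (.uy i (j + 1) k) := der_X _ _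
theorem dZ_ut (i j l : ℕ) : dZ (X (.ut i j l)) = X (.ut i (j + 1) l) := der_X _ _
theorem dZ_r (n a b : ℕ) : dZ (X (.r n a b)) = X (.r n a (b + 1)) := der_X _ _
theorem dZ_x : dZ (X .x) = 0 := der_X _ _
theorem dZ_y : dZ (X .y) = 0 := der_X _ _
theorem dZ_z : dZ (X .z) = 1 := der_X _ _
theorem dZ_t : dZ (X .t) = 0 := der_X _ _
theorem dT_u (i j : ℕ) : dT (X (.u i j)) = X (.ut i j 0) := der_X _ _
theorem dT_ut (i j l : ℕ) : dT (X (.ut i j l)) = X (.ut i j (l + 1)) := der_X _ _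
theorem dT_q (n a b : ℕ) : dT (X (.q n a b)) = X (.q n a (b + 1)) := der_X _ _
theorem dT_x : dT (X .x) = 0 := der_X _ _
theorem dT_y : dT (X .y) = 0 := der_X _ _
theorem dT_z : dT (X .z) = 0 := der_X _ _
theorem dT_t : dT (X .t) = 1 := der_X _ _

theorem dY_q (n a b : ℕ) :
    dY (X (.q n a b)) = dX^[a] (dT^[b] (X (.uy 0 0 0) * dX (qA n))) := der_X _ _

theorem dZ_q (n a b : ℕ) :
    dZ (X (.q n a b)) = dX^[a] (dT^[b] (X (.u 0 1) * dX (qA n) - dT (qA n))) := der_X _ _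

theorem rx_mem (i : ℤ) : uyInv * dY (rA i) ∈ algYR := mul_mem uyInv_mem (dY_mem (rA_mem i))

theorem rt_mem (i : ℤ) : X (.u 0 1) * uyInv * dY (rA i) - dZ (rA i) ∈ algYR :=
  sub_mem (mul_mem (mul_mem (X_mem trivial) uyInv_mem) (dY_mem (rA_mem i))) (dZ_mem (rA_mem i))

theorem dX_r (n a b : ℕ) : dX (X (.r n a b)) = dY^[a] (dZ^[b] (uyInv * dY (rA n))) := by
  rw [dX, der_X, xTot, ← dY_eq_shift (rA_mem n), iterate_zShift (algYR_le (rx_mem n)),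
    iterate_yShift (iterate_dZ_mem (rx_mem n) b)]

theorem dT_r (n a b : ℕ) :
    dT (X (.r n a b)) = dY^[a] (dZ^[b] (X (.u 0 1) * uyInv * dY (rA n) - dZ (rA n))) := by
  rw [dT, der_X, tTot, ← dY_eq_shift (rA_mem n), ← dZ_eq_shift (algYR_le (rA_mem n)),
    iterate_zShift (algYR_le (rt_mem n)), iterate_yShift (iterate_dZ_mem (rt_mem n) b)]

theorem dT_uy (i j k : ℕ) : dT (X (.uy i j k)) = dX^[i] (dZ^[j] (dY^[k] rhsA)) := by
  rw [dT, der_X, tTot, iterate_yShift rhsA_mem, iterate_zShift (algYR_le (iterate_dY_mem rhsA_mem k))]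
  rfl

theorem dX_mem {a : Alg} (ha : a ∈ algYR) : dX a ∈ algYR := by
  refine derivation_mapsTo trivial (fun c hc => ?_) ha
  cases c with
  | ut => exact hc.elim
  | q => exact hc.elim
  | r n a b => rw [dX_r]; exact iterate_dY_mem (iterate_dZ_mem (rx_mem n) b) a
  | u => rw [dX_u]; exact X_mem trivial
  | uy => rw [dX_uy]; exact X_mem trivial
  | x => rw [dX_x]; exact one_mem _
  | y => rw [dX_y]; exact zero_mem _
  | z => rw [dX_z]; exact zero_mem _
  | t => rw [dX_t]; exact zero_mem _

theorem dT_mem {a : Alg} (ha : a ∈ algLR) : dT a ∈ algLR := by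
  refine derivation_mapsTo trivial (fun c hc => ?_) ha
  cases c with
  | q => exact hc.elim
  | r n a b => rw [dT_r]; exact algYR_le (iterate_dY_mem (iterate_dZ_mem (rt_mem n) b) a)
  | u => rw [dT_u]; exact X_mem trivial
  | uy i j k =>
    rw [dT_uy]
    exact algYR_le (iterate_mem (fun _ => dX_mem) (iterate_dZ_mem (iterate_dY_mem rhsA_mem k) j) i)
  | ut => rw [dT_ut]; exact X_mem trivial
  | x => rw [dT_x]; exact zero_mem _
  | y => rw [dT_y]; exact zero_mem _
  | z => rw [dT_z]; exact zero_mem _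
  | t => rw [dT_t]; exact one_mem _

theorem iterate_dT_mem {a : Alg} (ha : a ∈ algLR) (n : ℕ) : dT^[n] a ∈ algLR :=
  iterate_mem (fun _ => dT_mem) ha n

theorem dY_ut (i j l : ℕ) : dY (X (.ut i j l)) = dX^[i] (dZ^[j] (dT^[l] rhsA)) := by
  rw [dY, der_X, yTot, ← dT, iterate_zShift (iterate_dT_mem (algYR_le rhsA_mem) l)]
  rfl

/-! ### The total derivatives commute -/

theorem dY_dZ_of_mem {a : Alg} (ha : a ∈ algYR) : dY (dZ a) = dZ (dY a) := by
  refine derivation_commOn trivial (fun c hc => ?_) ha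
  cases c <;> first | exact hc.elim | simp [dY_u, dY_uy, dY_r, dY_x, dY_y, dY_z,
    dY_t, dZ_u, dZ_uy, dZ_r, dZ_x, dZ_y, dZ_z, dZ_t]

theorem dX_dY (a : Alg) : dX (dY a) = dY (dX a) := by
  refine derivation_comm (fun c => ?_) a
  cases c with
  | ut => rw [dX_ut, dY_ut, dY_ut, Function.iterate_succ_apply']
  | q => rw [dX_q, dY_q, dY_q, Function.iterate_succ_apply']
  | r => rw [dY_r, dX_r, dX_r, Function.iterate_succ_apply']
  | _ => simp [dX_u, dX_uy, dX_x, dX_y, dX_z, dX_t, dY_u, dY_uy, dY_x, dY_y, dY_z, dY_t]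

theorem dX_dZ (a : Alg) : dX (dZ a) = dZ (dX a) := by
  refine derivation_comm (fun c => ?_) a
  cases c with
  | q => rw [dX_q, dZ_q, dZ_q, Function.iterate_succ_apply']
  | r n a b =>
    rw [dZ_r, dX_r, dX_r, Function.iterate_succ_apply', apply_iterate_of_mem (fun _ => dY_mem)
      (fun _ h => (dY_dZ_of_mem h).symm) (iterate_dZ_mem (rx_mem n) b)]
  | _ => simp [dX_u, dX_uy, dX_ut, dX_x, dX_y, dX_z, dX_t, dZ_u, dZ_uy, dZ_ut, dZ_x, dZ_y, dZ_z,
      dZ_t]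

theorem dT_dY_of_mem {a : Alg} (ha : a ∈ algYR) : dT (dY a) = dY (dT a) := by
  refine derivation_commOn trivial (fun c hc => ?_) ha
  cases c with
  | ut => exact hc.elim
  | q => exact hc.elim
  | r => rw [dY_r, dT_r, dT_r, Function.iterate_succ_apply']
  | u => rw [dY_u, dT_u, dT_uy, dY_ut]; rfl
  | uy i j k =>
    rw [dY_uy, dT_uy, dT_uy, apply_iterate (fun a => (dX_dY a).symm), apply_iterate_of_mem
      (fun _ => dZ_mem) (fun _ => dY_dZ_of_mem) (iterate_dY_mem rhsA_mem k),
      Function.iterate_succ_apply']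
  | _ => simp [dT_x, dT_y, dT_z, dT_t, dY_x, dY_y, dY_z, dY_t]

theorem dT_dZ_of_mem {a : Alg} (ha : a ∈ algLR) : dT (dZ a) = dZ (dT a) := by
  refine derivation_commOn trivial (fun c hc => ?_) ha
  cases c with
  | q => exact hc.elim
  | ut => simp [dT_ut, dZ_ut]
  | r n a b =>
    rw [dZ_r, dT_r, dT_r, Function.iterate_succ_apply', apply_iterate_of_mem (fun _ => dY_mem)
      (fun _ h => (dY_dZ_of_mem h).symm) (iterate_dZ_mem (rt_mem n) b)]
  | u => simp [dT_u, dZ_u, dZ_ut]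
  | uy i j k =>
    rw [dZ_uy, dT_uy, dT_uy, apply_iterate (fun a => (dX_dZ a).symm), Function.iterate_succ_apply']
  | _ => simp [dT_x, dT_y, dT_z, dT_t, dZ_x, dZ_y, dZ_z, dZ_t]

theorem dX_rA_succ (n : ℕ) : dX (rA (n + 1)) = uyInv * dY (rA n) := dX_r n 0 0

theorem dT_rA_succ (n : ℕ) : dT (rA (n + 1)) = X (.u 0 1) * uyInv * dY (rA n) - dZ (rA n) :=
  dT_r n 0 0

theorem dX_rA_zero : dX (rA 0) = 0 := dX_y

theorem dT_rA_zero : dT (rA 0) = 0 := dT_y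

theorem dT_uy0 : dT (X (.uy 0 0 0)) = rhsA := dT_uy 0 0 0

theorem dX_dT_r_aux (n : ℕ) :
    dX (X (.u 0 1) * uyInv * dY (rA n) - dZ (rA n)) = dT (uyInv * dY (rA n)) := by
  have h := uy_mul_uyInv
  simp only [map_sub, Derivation.leibniz, smul_eq_mul, derivation_uyInv, dX_dY, dX_dZ,
    dT_dY_of_mem (rA_mem n), dX_u, dX_uy, dT_uy0, rhsA, zero_add]
  cases n with
  | zero =>
    simp only [Nat.cast_zero, dX_rA_zero, dT_rA_zero, map_zero]
    linear_combination (- X (.u 1 1) * uyInv * dY (rA 0)) * h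
  | succ n =>
    simp only [Nat.cast_succ, dX_rA_succ, dT_rA_succ, map_sub, Derivation.leibniz, smul_eq_mul,
      derivation_uyInv, dY_u, dY_uy, dZ_uy, dY_dZ_of_mem (rA_mem n), zero_add]
    linear_combination (- X (.u 1 1) * uyInv * dY (rA (n + 1))) * h

theorem dX_dT (a : Alg) : dX (dT a) = dT (dX a) := by
  refine derivation_comm (fun c => ?_) a
  cases c with
  | r n a b =>
    rw [dX_r, dT_r, apply_iterate dX_dY, apply_iterate dX_dZ, apply_iterate_of_mem
      (fun _ => dY_mem) (fun _ => dT_dY_of_mem) (iterate_dZ_mem (rx_mem n) b),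
      apply_iterate_of_mem (fun _ => dZ_mem) (fun _ h => dT_dZ_of_mem (algYR_le h)) (rx_mem n),
      dX_dT_r_aux]
  | uy i j k => rw [dX_uy, dT_uy, dT_uy, Function.iterate_succ_apply']
  | _ => simp [dX_u, dX_ut, dX_q, dX_x, dX_y, dX_z, dX_t, dT_u, dT_ut, dT_q, dT_x, dT_y, dT_z, dT_t]

theorem dT_dY (a : Alg) : dT (dY a) = dY (dT a) := by
  refine derivation_comm (fun c => ?_) a
  cases c with
  | ut i j l =>
    rw [dT_ut, dY_ut, dY_ut, apply_iterate (fun a => (dX_dT a).symm), apply_iterate_of_mem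
      (fun _ => dZ_mem') (fun _ => dT_dZ_of_mem) (iterate_dT_mem (algYR_le rhsA_mem) l),
      Function.iterate_succ_apply']
  | q n a b =>
    rw [dT_q, dY_q, dY_q, apply_iterate (fun a => (dX_dT a).symm), Function.iterate_succ_apply']
  | _ => exact dT_dY_of_mem (X_mem trivial)

theorem dT_dZ (a : Alg) : dT (dZ a) = dZ (dT a) := by
  refine derivation_comm (fun c => ?_) a
  cases c with
  | q n a b =>
    rw [dT_q, dZ_q, dZ_q, apply_iterate (fun a => (dX_dT a).symm), Function.iterate_succ_apply']
  | _ => exact dT_dZ_of_mem (X_mem trivial)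

theorem dY_qA_succ (n : ℕ) : dY (qA (n + 1)) = X (.uy 0 0 0) * dX (qA n) := dY_q n 0 0

theorem dZ_qA_succ (n : ℕ) : dZ (qA (n + 1)) = X (.u 0 1) * dX (qA n) - dT (qA n) := dZ_q n 0 0

theorem qA_zero : qA 0 = X (.u 0 0) := rfl

theorem dY_ut0 : dY (X (.ut 0 0 0)) = rhsA := dY_ut 0 0 0

theorem dY_dZ (a : Alg) : dY (dZ a) = dZ (dY a) := by
  refine derivation_comm (fun c => ?_) a
  cases c with
  | ut i j l =>
    rw [dZ_ut, dY_ut, dY_ut, apply_iterate (fun a => (dX_dZ a).symm), Function.iterate_succ_apply']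
  | q n a b =>
    have h : dY (X (.u 0 1) * dX (qA n) - dT (qA n)) = dZ (X (.uy 0 0 0) * dX (qA n)) := by
      simp only [map_sub, Derivation.leibniz, smul_eq_mul, ← dX_dY, ← dX_dZ, ← dT_dY, dY_u, dZ_uy]
      cases n with
      | zero =>
        simp only [Nat.cast_zero, qA_zero, dY_u, dZ_u, dX_u, dX_uy, dT_uy0, rhsA, zero_add]
        ring
      | succ n =>
        simp only [Nat.cast_succ, dY_qA_succ, dZ_qA_succ, map_sub, Derivation.leibniz, smul_eq_mul,
          dX_u, dX_uy, dT_uy0, dX_dT, rhsA, zero_add]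
        ring
    rw [dZ_q, dY_q, apply_iterate (fun a => (dX_dY a).symm), apply_iterate (fun a => (dT_dY a).symm),
      apply_iterate (fun a => (dX_dZ a).symm), apply_iterate (fun a => (dT_dZ a).symm), h]
  | _ => exact dY_dZ_of_mem (X_mem trivial)

/-! ## Symmetries as derivations -/

theorem dY_iterate_dX (a : Alg) (n : ℕ) : dY (dX^[n] a) = dX^[n] (dY a) :=
  apply_iterate (fun a => (dX_dY a).symm) a n
theorem dZ_iterate_dX (a : Alg) (n : ℕ) : dZ (dX^[n] a) = dX^[n] (dZ a) :=
  apply_iterate (fun a => (dX_dZ a).symm) a n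
theorem dT_iterate_dX (a : Alg) (n : ℕ) : dT (dX^[n] a) = dX^[n] (dT a) :=
  apply_iterate (fun a => (dX_dT a).symm) a n
theorem dY_iterate_dZ (a : Alg) (n : ℕ) : dY (dZ^[n] a) = dZ^[n] (dY a) :=
  apply_iterate dY_dZ a n
theorem dT_iterate_dZ (a : Alg) (n : ℕ) : dT (dZ^[n] a) = dZ^[n] (dT a) :=
  apply_iterate dT_dZ a n
theorem dX_iterate_dY (a : Alg) (n : ℕ) : dX (dY^[n] a) = dY^[n] (dX a) :=
  apply_iterate dX_dY a n
theorem dX_iterate_dZ (a : Alg) (n : ℕ) : dX (dZ^[n] a) = dZ^[n] (dX a) :=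
  apply_iterate dX_dZ a n
theorem dZ_iterate_dY (a : Alg) (n : ℕ) : dZ (dY^[n] a) = dY^[n] (dZ a) :=
  apply_iterate (fun a => (dY_dZ a).symm) a n
theorem dT_iterate_dY (a : Alg) (n : ℕ) : dT (dY^[n] a) = dY^[n] (dT a) :=
  apply_iterate dT_dY a n
theorem dY_iterate_dT (a : Alg) (n : ℕ) : dY (dT^[n] a) = dT^[n] (dY a) :=
  apply_iterate (fun a => (dT_dY a).symm) a n
theorem dZ_iterate_dT (a : Alg) (n : ℕ) : dZ (dT^[n] a) = dT^[n] (dZ a) :=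
  apply_iterate (fun a => (dT_dZ a).symm) a n

/-- A vertical derivation commuting with the total derivatives. -/
structure Sym (S : Derivation ℝ Alg Alg) : Prop where
  x : S (X .x) = 0
  y : S (X .y) = 0
  z : S (X .z) = 0
  t : S (X .t) = 0
  cX : ∀ a, S (dX a) = dX (S a)
  cY : ∀ a, S (dY a) = dY (S a)
  cZ : ∀ a, S (dZ a) = dZ (S a)
  cT : ∀ a, S (dT a) = dT (S a)

theorem Sym.comm {S S' : Derivation ℝ Alg Alg} (h : Sym S) (h' : Sym S') : Sym ⁅S, S'⁆ := by
  constructor <;> intros <;> simp only [Derivation.commutator_apply, h.x, h'.x, h.y, h'.y, h.z,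
    h'.z, h.t, h'.t, h.cX, h'.cX, h.cY, h'.cY, h.cZ, h'.cZ, h.cT, h'.cT, map_zero, map_sub, sub_self]

theorem Sym.smul {S : Derivation ℝ Alg Alg} (h : Sym S) (r : ℝ) : Sym (r • S) := by
  constructor <;> intros <;> simp only [Derivation.smul_apply, h.x, h.y, h.z, h.t, h.cX, h.cY,
    h.cZ, h.cT, smul_zero, Derivation.map_smul]

/-- The coefficients of `field φ φm φp`. -/
def fieldA (φ : Alg) (φm φp : ℤ → Alg) : Coord → Alg
  | .x => 0
  | .y => 0
  | .z => 0
  | .t => 0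
  | .u i j => dX^[i] (dZ^[j] φ)
  | .uy i j k => dX^[i] (dZ^[j] (dY^[k + 1] φ))
  | .ut i j l => dX^[i] (dZ^[j] (dT^[l + 1] φ))
  | .r n a b => dY^[a] (dZ^[b] (φm (n + 1)))
  | .q n a b => dX^[a] (dT^[b] (φp (n + 1)))

theorem rep_field {φ : Fn} {φm φp : ℤ → Fn} {φ' : Alg} {φm' φp' : ℤ → Alg} (h : Rep φ φ')
    (hm : ∀ i, Rep (φm i) (φm' i)) (hp : ∀ i, Rep (φp i) (φp' i)) (c : Coord) :
    Rep (field φ φm φp c) (fieldA φ' φm' φp' c) := by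
  cases c with
  | u i j => exact Rep.iterate rep_Dx (Rep.iterate rep_Dz h _) _
  | uy i j k => exact Rep.iterate rep_Dx (Rep.iterate rep_Dz (Rep.iterate rep_Dy h _) _) _
  | ut i j l => exact Rep.iterate rep_Dx (Rep.iterate rep_Dz (Rep.iterate rep_Dt h _) _) _
  | r n a b => exact Rep.iterate rep_Dy (Rep.iterate rep_Dz (hm _) _) _
  | q n a b => exact Rep.iterate rep_Dx (Rep.iterate rep_Dt (hp _) _) _
  | _ => exact Rep.zero

section FieldSym

variable {φ : Alg} {φm φp : ℤ → Alg}

theorem field_u (i j : ℕ) : der (fieldA φ φm φp) (X (.u i j)) = dX^[i] (dZ^[j] φ) := der_X _ _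
theorem field_uy (i j k : ℕ) :
    der (fieldA φ φm φp) (X (.uy i j k)) = dX^[i] (dZ^[j] (dY^[k + 1] φ)) := der_X _ _
theorem field_ut (i j l : ℕ) :
    der (fieldA φ φm φp) (X (.ut i j l)) = dX^[i] (dZ^[j] (dT^[l + 1] φ)) := der_X _ _
theorem field_r (n a b : ℕ) :
    der (fieldA φ φm φp) (X (.r n a b)) = dY^[a] (dZ^[b] (φm (n + 1))) := der_X _ _
theorem field_q (n a b : ℕ) :
    der (fieldA φ φm φp) (X (.q n a b)) = dX^[a] (dT^[b] (φp (n + 1))) := der_X _ _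
theorem field_x : der (fieldA φ φm φp) (X .x) = 0 := der_X _ _
theorem field_y : der (fieldA φ φm φp) (X .y) = 0 := der_X _ _
theorem field_z : der (fieldA φ φm φp) (X .z) = 0 := der_X _ _
theorem field_t : der (fieldA φ φm φp) (X .t) = 0 := der_X _ _

theorem field_qA (h0 : φp 0 = φ) (n : ℕ) : der (fieldA φ φm φp) (qA n) = φp n := by
  cases n with
  | zero => rw [Nat.cast_zero, h0]; exact field_u 0 0
  | succ n => exact field_q n 0 0

theorem field_rA (h0 : φm 0 = 0) (n : ℕ) : der (fieldA φ φm φp) (rA n) = φm n := by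
  cases n with
  | zero => rw [Nat.cast_zero, h0]; exact field_y
  | succ n => exact field_r n 0 0

theorem field_dY_of_mem {a : Alg} (ha : a ∈ algYR) :
    der (fieldA φ φm φp) (dY a) = dY (der (fieldA φ φm φp) a) := by
  refine derivation_commOn trivial (fun c hc => ?_) ha
  cases c with
  | ut => exact hc.elim
  | q => exact hc.elim
  | u => rw [dY_u, field_u, field_uy, dY_iterate_dX, dY_iterate_dZ]; rfl
  | uy => rw [dY_uy, field_uy, field_uy, dY_iterate_dX, dY_iterate_dZ,
      Function.iterate_succ_apply' _ (_ + 1)]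
  | r => rw [dY_r, field_r, field_r, Function.iterate_succ_apply']
  | _ => simp only [field_x, field_y, field_z, field_t, dY_x, dY_y, dY_z, dY_t, map_zero,
      Derivation.map_one_eq_zero]

theorem field_dZ_of_mem {a : Alg} (ha : a ∈ algLR) :
    der (fieldA φ φm φp) (dZ a) = dZ (der (fieldA φ φm φp) a) := by
  refine derivation_commOn trivial (fun c hc => ?_) ha
  cases c with
  | q => exact hc.elim
  | u => rw [dZ_u, field_u, field_u, dZ_iterate_dX, Function.iterate_succ_apply']
  | uy => rw [dZ_uy, field_uy, field_uy, dZ_iterate_dX, Function.iterate_succ_apply' dZ]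
  | ut => rw [dZ_ut, field_ut, field_ut, dZ_iterate_dX, Function.iterate_succ_apply' dZ]
  | r => rw [dZ_r, field_r, field_r, dZ_iterate_dY, Function.iterate_succ_apply']
  | _ => simp only [field_x, field_y, field_z, field_t, dZ_x, dZ_y, dZ_z, dZ_t, map_zero,
      Derivation.map_one_eq_zero]

theorem sym_field (hp0 : φp 0 = φ) (hm0 : φm 0 = 0)
    (hpY : ∀ n : ℕ, dY (φp (n + 1)) = dY φ * dX (qA n) + X (.uy 0 0 0) * dX (φp n))
    (hpZ : ∀ n : ℕ, dZ (φp (n + 1)) = dZ φ * dX (qA n) + X (.u 0 1) * dX (φp n) - dT (φp n))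
    (hmY : ∀ n : ℕ, dY (φm n) = dY φ * dX (rA (n + 1)) + X (.uy 0 0 0) * dX (φm (n + 1)))
    (hmZ : ∀ n : ℕ, dZ (φm n) = dZ φ * dX (rA (n + 1)) + X (.u 0 1) * dX (φm (n + 1))
      - dT (φm (n + 1))) :
    Sym (der (fieldA φ φm φp)) := by
  have hφuy : der (fieldA φ φm φp) (X (.uy 0 0 0)) = dY φ := field_uy 0 0 0
  have hφuz : der (fieldA φ φm φp) (X (.u 0 1)) = dZ φ := field_u 0 1
  have hell : dT (dY φ) = der (fieldA φ φm φp) rhsA := by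
    have h := hpY 0
    have h' := hpZ 0
    simp only [Nat.cast_zero, hp0, zero_add, qA_zero, dX_u] at h h'
    have h1 : dZ (dY (φp 1)) = dY (dZ (φp 1)) := (dY_dZ _).symm
    rw [h, h'] at h1
    have e1 : der (fieldA φ φm φp) (X (.uy 1 0 0)) = dX (dY φ) := field_uy 1 0 0
    have e2 : der (fieldA φ φm φp) (X (.u 1 1)) = dX (dZ φ) := field_u 1 1
    simp only [map_sub, map_add, Derivation.leibniz, smul_eq_mul, dY_u, dZ_u, dZ_uy, ← dX_dY,
      ← dX_dZ, ← dT_dY, ← dY_dZ, zero_add] at h1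
    simp only [rhsA, map_sub, Derivation.leibniz, smul_eq_mul, hφuy, hφuz, e1, e2]
    linear_combination h1
  have cX : ∀ a, der (fieldA φ φm φp) (dX a) = dX (der (fieldA φ φm φp) a) := by
    refine derivation_comm fun c => ?_
    cases c with
    | u => rw [dX_u, field_u, field_u, Function.iterate_succ_apply']
    | uy => rw [dX_uy, field_uy, field_uy, Function.iterate_succ_apply' dX]
    | ut => rw [dX_ut, field_ut, field_ut, Function.iterate_succ_apply' dX]
    | q => rw [dX_q, field_q, field_q, Function.iterate_succ_apply']
    | r n a b =>
      have e : der (fieldA φ φm φp) (uyInv * dY (rA n)) = dX (φm (n + 1)) := by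
        rw [Derivation.leibniz, derivation_uyInv, field_dY_of_mem (rA_mem n), field_rA hm0, hmY,
          hφuy, dX_rA_succ]
        simp only [smul_eq_mul]
        linear_combination dX (φm (n + 1)) * uy_mul_uyInv
      rw [dX_r, field_r, dX_iterate_dY, dX_iterate_dZ, apply_iterate_of_mem (fun _ => dY_mem)
        (fun _ => field_dY_of_mem) (iterate_dZ_mem (rx_mem n) b), apply_iterate_of_mem
        (fun _ => dZ_mem) (fun _ h => field_dZ_of_mem (algYR_le h)) (rx_mem n), e]
    | _ => simp only [field_x, field_y, field_z, field_t, dX_x, dX_y, dX_z, dX_t, map_zero,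
      Derivation.map_one_eq_zero]
  have cT : ∀ a, der (fieldA φ φm φp) (dT a) = dT (der (fieldA φ φm φp) a) := by
    refine derivation_comm fun c => ?_
    cases c with
    | u => rw [dT_u, field_u, field_ut, dT_iterate_dX, dT_iterate_dZ]; rfl
    | ut => rw [dT_ut, field_ut, field_ut, dT_iterate_dX, dT_iterate_dZ,
        Function.iterate_succ_apply' dT (_ + 1)]
    | q => rw [dT_q, field_q, field_q, dT_iterate_dX, Function.iterate_succ_apply']
    | uy i j k =>
      rw [dT_uy, field_uy, dT_iterate_dX, dT_iterate_dZ, Function.iterate_succ_apply,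
        dT_iterate_dY, hell, apply_iterate cX, apply_iterate_of_mem (fun _ => dZ_mem)
        (fun _ h => field_dZ_of_mem (algYR_le h)) (iterate_dY_mem rhsA_mem k),
        apply_iterate_of_mem (fun _ => dY_mem) (fun _ => field_dY_of_mem) rhsA_mem]
    | r n a b =>
      have e : der (fieldA φ φm φp) (X (.u 0 1) * uyInv * dY (rA n) - dZ (rA n))
          = dT (φm (n + 1)) := by
        simp only [map_sub, Derivation.leibniz, derivation_uyInv, field_dY_of_mem (rA_mem n),
          field_dZ_of_mem (algYR_le (rA_mem n)), field_rA hm0, hφuy, hφuz, smul_eq_mul]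
        rw [hmY, hmZ, dX_rA_succ]
        linear_combination X (.u 0 1) * dX (φm (n + 1)) * uy_mul_uyInv
      rw [dT_r, field_r, dT_iterate_dY, dT_iterate_dZ, apply_iterate_of_mem (fun _ => dY_mem)
        (fun _ => field_dY_of_mem) (iterate_dZ_mem (rt_mem n) b), apply_iterate_of_mem
        (fun _ => dZ_mem) (fun _ h => field_dZ_of_mem (algYR_le h)) (rt_mem n), e]
    | _ => simp only [field_x, field_y, field_z, field_t, dT_x, dT_y, dT_z, dT_t, map_zero,
      Derivation.map_one_eq_zero]
  refine ⟨field_x, field_y, field_z, field_t, cX, ?_, ?_, cT⟩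
  · refine derivation_comm fun c => ?_
    cases c with
    | ut i j l =>
      rw [dY_ut, field_ut, dY_iterate_dX, dY_iterate_dZ, dY_iterate_dT, Function.iterate_succ_apply,
        hell, apply_iterate cX, apply_iterate_of_mem (fun _ => dZ_mem')
        (fun _ => field_dZ_of_mem) (iterate_dT_mem (algYR_le rhsA_mem) l), apply_iterate cT]
    | q n a b =>
      rw [dY_q, field_q, dY_iterate_dX, dY_iterate_dT, apply_iterate cX, apply_iterate cT,
        Derivation.leibniz, cX, hφuy, field_qA hp0, hpY, smul_eq_mul, smul_eq_mul,
        mul_comm (dX (qA n)), add_comm]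
    | _ => exact field_dY_of_mem (X_mem trivial)
  · refine derivation_comm fun c => ?_
    cases c with
    | q n a b =>
      rw [dZ_q, field_q, dZ_iterate_dX, dZ_iterate_dT, apply_iterate cX, apply_iterate cT,
        map_sub, Derivation.leibniz, cX, cT, hφuz, field_qA hp0, hpZ, smul_eq_mul, smul_eq_mul,
        mul_comm (dX (qA n)), add_comm (dZ φ * _)]
    | _ => exact field_dZ_of_mem (X_mem trivial)

end FieldSym

/-! ### From derivations back to vector fields -/

theorem rep_comm {V W : VField} {ξ η : Coord → Alg} (hV : ∀ c, Rep (V c) (ξ c))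
    (hW : ∀ c, Rep (W c) (η c)) (c : Coord) :
    Rep (comm V W c) (⁅der ξ, der η⁆ (X c)) := by
  rw [Derivation.commutator_apply, der_X, der_X]
  exact (Rep.act hV (hW c)).sub (Rep.act hW (hV c))

/-- `V` has the coefficients of the derivation `S`. -/
def RepField (V : VField) (S : Derivation ℝ Alg Alg) : Prop := ∀ c, Rep (V c) (S (X c))

theorem der_eq (S : Derivation ℝ Alg Alg) : der (fun c => S (X c)) = S :=
  derivation_ext fun c => der_X _ c

theorem RepField.der {V : VField} {ξ : Coord → Alg} (h : ∀ c, Rep (V c) (ξ c)) :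
    RepField V (der ξ) := fun c => by rw [der_X]; exact h c

theorem RepField.comm {V W : VField} {S S' : Derivation ℝ Alg Alg} (h : RepField V S)
    (h' : RepField W S') : RepField (comm V W) ⁅S, S'⁆ := by
  intro c
  have := rep_comm h h' c
  rwa [der_eq, der_eq] at this

theorem RepField.smul {V : VField} {S : Derivation ℝ Alg Alg} (h : RepField V S) (r : ℝ) :
    RepField (r • V) (r • S) := fun c => (h c).smul r

theorem RepField.isSymmetry {V : VField} {S : Derivation ℝ Alg Alg} (h : RepField V S)
    (hS : Sym S) : IsSymmetry V where
  smooth c := Rep.isSmooth (h c)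
  vert_x := (h .x).sameOn Rep.zero hS.x
  vert_y := (h .y).sameOn Rep.zero hS.y
  vert_z := (h .z).sameOn Rep.zero hS.z
  vert_t := (h .t).sameOn Rep.zero hS.t
  cartan := by
    have key : ∀ (D : VField) (D' : Derivation ℝ Alg Alg), RepField D D' →
        (∀ a, S (D' a) = D' (S a)) → ∃ a₁ a₂ a₃ a₄ : Fn, ∀ c,
          SameOn (MASh.comm V D c) (a₁ * Dx c + a₂ * Dy c + a₃ * Dz c + a₄ * Dt c) := by
      intro D D' hD hc
      refine ⟨0, 0, 0, 0, fun c => ?_⟩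
      simp only [zero_mul, add_zero]
      refine (RepField.comm h hD c).sameOn Rep.zero ?_
      rw [Derivation.commutator_apply, hc, sub_self]
    rintro D (rfl | rfl | rfl | rfl)
    · exact key _ _ (RepField.der rep_Dx) hS.cX
    · exact key _ _ (RepField.der rep_Dy) hS.cY
    · exact key _ _ (RepField.der rep_Dz) hS.cZ
    · exact key _ _ (RepField.der rep_Dt) hS.cT

theorem iterate_dX_u (j i : ℕ) : X (.u i j) = dX^[i] (X (.u 0 j)) := by
  induction i with
  | zero => rfl
  | succ i ih => rw [Function.iterate_succ_apply', ← ih, dX_u]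

theorem iterate_dZ_u (j : ℕ) : X (.u 0 j) = dZ^[j] (X (.u 0 0)) := by
  induction j with
  | zero => rfl
  | succ i ih => rw [Function.iterate_succ_apply', ← ih, dZ_u]

theorem iterate_dX_uy (j k i : ℕ) : X (.uy i j k) = dX^[i] (X (.uy 0 j k)) := by
  induction i with
  | zero => rfl
  | succ i ih => rw [Function.iterate_succ_apply', ← ih, dX_uy]

theorem iterate_dZ_uy (k j : ℕ) : X (.uy 0 j k) = dZ^[j] (X (.uy 0 0 k)) := by
  induction j with
  | zero => rfl
  | succ i ih => rw [Function.iterate_succ_apply', ← ih, dZ_uy]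

theorem iterate_dY_u (k : ℕ) : X (.uy 0 0 k) = dY^[k + 1] (X (.u 0 0)) := by
  induction k with
  | zero => exact (dY_u 0 0).symm
  | succ i ih => rw [Function.iterate_succ_apply', ← ih, dY_uy]

theorem iterate_dX_ut (j l i : ℕ) : X (.ut i j l) = dX^[i] (X (.ut 0 j l)) := by
  induction i with
  | zero => rfl
  | succ i ih => rw [Function.iterate_succ_apply', ← ih, dX_ut]

theorem iterate_dZ_ut (l j : ℕ) : X (.ut 0 j l) = dZ^[j] (X (.ut 0 0 l)) := by
  induction j with
  | zero => rfl
  | succ i ih => rw [Function.iterate_succ_apply', ← ih, dZ_ut]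

theorem iterate_dT_u (l : ℕ) : X (.ut 0 0 l) = dT^[l + 1] (X (.u 0 0)) := by
  induction l with
  | zero => exact (dT_u 0 0).symm
  | succ i ih => rw [Function.iterate_succ_apply', ← ih, dT_ut]

theorem Sym.apply_local {S : Derivation ℝ Alg Alg} (hS : Sym S) (c : Coord) (hc : IsLocal c) :
    S (X c) = fieldA (S (X (.u 0 0))) 0 0 c := by
  cases c with
  | x => exact hS.x
  | y => exact hS.y
  | z => exact hS.z
  | t => exact hS.t
  | r => exact hc.elim
  | q => exact hc.elim
  | u i j =>
    rw [iterate_dX_u, iterate_dZ_u, apply_iterate hS.cX, apply_iterate hS.cZ]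
    rfl
  | uy i j k =>
    rw [iterate_dX_uy, iterate_dZ_uy, iterate_dY_u, apply_iterate hS.cX, apply_iterate hS.cZ,
      apply_iterate hS.cY]
    rfl
  | ut i j l =>
    rw [iterate_dX_ut, iterate_dZ_ut, iterate_dT_u, apply_iterate hS.cX, apply_iterate hS.cZ,
      apply_iterate hS.cT]
    rfl

theorem RepField.isLift {V : VField} {S : Derivation ℝ Alg Alg} (h : RepField V S)
    (hS : Sym S) {φ : Fn} (hφ : Rep φ (S (X (.u 0 0)))) : IsLift V φ :=
  ⟨h.isSymmetry hS, fun c hc =>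
    (h c).sameOn (rep_field hφ (fun _ => Rep.zero) (fun _ => Rep.zero) c) (hS.apply_local c hc)⟩

theorem isShadow_of_sym {S : Derivation ℝ Alg Alg} (hS : Sym S) {φ : Fn}
    (hφ : Rep φ (S (X (.u 0 0)))) : IsShadow φ := by
  refine ⟨Rep.isSmooth hφ, ?_⟩
  have h := congrArg S (dT_uy 0 0 0)
  have hY := Rep.act rep_Dy hφ
  have hZ := Rep.act rep_Dz hφ
  have hT := Rep.act rep_Dt hφ
  refine Rep.sameOn (((((Rep.act rep_Dy hT).sub ((Rep.co _).mul hZ)).add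
    ((Rep.co _).mul hY)).sub ((Rep.co _).mul (Rep.act rep_Dx hY))).add
      ((Rep.co _).mul (Rep.act rep_Dx hZ))) Rep.zero ?_
  have e1 := hS.apply_local (.uy 1 0 0) trivial
  have e2 := hS.apply_local (.u 1 1) trivial
  have e3 := hS.apply_local (.u 0 1) trivial
  have e4 := hS.apply_local (.uy 0 0 0) trivial
  simp only [fieldA, Function.iterate_one, Function.iterate_zero, id, zero_add] at e1 e2 e3 e4
  simp only [Function.iterate_zero, id, hS.cT, rhsA, map_sub, Derivation.leibniz, smul_eq_mul,
    e1, e2, e3, e4] at h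
  change dY (dT _) - _ * dZ _ + _ * dY _ - _ * dX (dY _) + _ * dX (dZ _) = 0
  rw [← dT_dY]
  linear_combination h

/-! ## Solutions of the Lax pair and their linearization -/

/-- The coefficients of a formal Laurent series annihilated by `D_y - λ u_y D_x` and
`D_z + λ D_t - λ u_z D_x`. -/
structure LaxSeq (f : ℤ → Alg) : Prop where
  eqY : ∀ j, dY (f j) = X (.uy 0 0 0) * dX (f (j - 1))
  eqZ : ∀ j, dZ (f j) = X (.u 0 1) * dX (f (j - 1)) - dT (f (j - 1))

/-- The linearization of the Lax pair at `f` in the direction `(φ, g)`. -/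
structure LinSeq (φ : Alg) (f g : ℤ → Alg) : Prop where
  eqY : ∀ j, dY (g j) = dY φ * dX (f (j - 1)) + X (.uy 0 0 0) * dX (g (j - 1))
  eqZ : ∀ j, dZ (g j) = dZ φ * dX (f (j - 1)) + X (.u 0 1) * dX (g (j - 1)) - dT (g (j - 1))

theorem rA_zero : rA 0 = X .y := rfl

/-- The sequence `r_{-j}`. -/
def rNeg (j : ℤ) : Alg := rA (-j)

theorem laxSeq_q : LaxSeq qA := by
  constructor <;> intro j
  · rcases j with (_ | n) | (_ | n)
    · change dY (X (.u 0 0)) = _ * dX (X .x)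
      rw [dY_u, dX_x, mul_one]
    · rw [show Int.ofNat (n + 1) - 1 = n by simp]
      exact dY_qA_succ n
    · change dY (X .x) = _ * dX 0
      rw [dY_x, map_zero, mul_zero]
    · change dY 0 = _ * dX 0
      rw [map_zero, map_zero, mul_zero]
  · rcases j with (_ | n) | (_ | n)
    · change dZ (X (.u 0 0)) = _ * dX (X .x) - dT (X .x)
      rw [dZ_u, dX_x, dT_x, mul_one, sub_zero]
    · rw [show Int.ofNat (n + 1) - 1 = n by simp]
      exact dZ_qA_succ n
    · change dZ (X .x) = _ * dX 0 - dT 0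
      rw [dZ_x, map_zero, map_zero, mul_zero, sub_zero]
    · change dZ 0 = _ * dX 0 - dT 0
      rw [map_zero, map_zero, map_zero, mul_zero, sub_zero]

theorem dY_rA (i : ℤ) : dY (rA i) = X (.uy 0 0 0) * dX (rA (i + 1)) := by
  rcases i with n | (_ | n)
  · change dY (rA n) = _ * dX (rA (n + 1))
    rw [dX_rA_succ]
    linear_combination -dY (rA n) * uy_mul_uyInv
  · change dY 0 = _ * dX (X .y)
    rw [dX_y, map_zero, mul_zero]
  · change dY 0 = _ * dX 0
    rw [map_zero, map_zero, mul_zero]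

theorem dZ_rA (i : ℤ) : dZ (rA i) = X (.u 0 1) * dX (rA (i + 1)) - dT (rA (i + 1)) := by
  rcases i with n | (_ | n)
  · change dZ (rA n) = _ * dX (rA (n + 1)) - dT (rA (n + 1))
    rw [dX_rA_succ, dT_rA_succ]
    ring
  · change dZ 0 = _ * dX (X .y) - dT (X .y)
    rw [dX_y, dT_y, map_zero, mul_zero, sub_zero]
  · change dZ 0 = _ * dX 0 - dT 0
    rw [map_zero, map_zero, map_zero, mul_zero, sub_zero]

theorem laxSeq_r : LaxSeq rNeg := by
  constructor <;> intro j
  · rw [rNeg, rNeg, dY_rA, show -(j - 1) = -j + 1 by ring]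
  · rw [rNeg, rNeg, dZ_rA, show -(j - 1) = -j + 1 by ring]

theorem sym_field_of_linSeq {φ : Alg} {φm φp : ℤ → Alg} (hp0 : φp 0 = φ) (hm0 : φm 0 = 0)
    (hp : LinSeq φ qA φp) (hm : LinSeq φ rNeg (fun j => φm (-j))) :
    Sym (der (fieldA φ φm φp)) := by
  refine sym_field hp0 hm0 (fun n => ?_) (fun n => ?_) (fun n => ?_) (fun n => ?_)
  · simpa using hp.eqY (n + 1)
  · simpa using hp.eqZ (n + 1)
  · simpa [rNeg, add_comm] using hm.eqY (-n)
  · simpa [rNeg, add_comm] using hm.eqZ (-n)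

theorem dY_q1 : dY (qA 1) = X (.uy 0 0 0) * X (.u 1 0) := (dY_qA_succ 0).trans (by
  rw [Nat.cast_zero, qA_zero, dX_u])

theorem dZ_q1 : dZ (qA 1) = X (.u 0 1) * X (.u 1 0) - X (.ut 0 0 0) := (dZ_qA_succ 0).trans (by
  rw [Nat.cast_zero, qA_zero, dX_u, dT_u])

theorem dX_r1 : dX (rA 1) = uyInv := (dX_rA_succ 0).trans (by
  rw [Nat.cast_zero, rA_zero, dY_y, mul_one])

theorem dT_r1 : dT (rA 1) = X (.u 0 1) * uyInv := (dT_rA_succ 0).trans (by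
  rw [Nat.cast_zero, rA_zero, dY_y, dZ_y, mul_one, sub_zero])

theorem dX_uyInv : dX uyInv = -(uyInv * uyInv * X (.uy 1 0 0)) := by
  rw [derivation_uyInv, dX_uy]
theorem dZ_uyInv : dZ uyInv = -(uyInv * uyInv * X (.uy 0 1 0)) := by
  rw [derivation_uyInv, dZ_uy]
theorem dT_uyInv : dT uyInv = -(uyInv * uyInv * rhsA) := by
  rw [derivation_uyInv, dT_uy0]

theorem LaxSeq.linSeq_dZ {f : ℤ → Alg} (hf : LaxSeq f) :
    LinSeq (-X (.u 0 1)) f (fun j => -dZ (f j)) := by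
  constructor <;> intro j
  · simp only [map_neg, dY_dZ, hf.eqY, Derivation.leibniz, smul_eq_mul, dZ_uy, dY_u, dX_dZ]
    ring
  · simp only [map_neg, dZ_u]
    rw [hf.eqZ j]
    simp only [map_sub, Derivation.leibniz, smul_eq_mul, dX_dZ, dT_dZ, dZ_u]
    ring

theorem LaxSeq.linSeq_dT {f : ℤ → Alg} (hf : LaxSeq f) :
    LinSeq (X (.ut 0 0 0)) f (fun j => dT (f j)) := by
  constructor <;> intro j
  · simp only [← dT_dY, hf.eqY, Derivation.leibniz, smul_eq_mul, dX_dT, dY_ut0, dT_uy0]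
    ring
  · simp only [← dT_dZ, hf.eqZ, Derivation.leibniz, smul_eq_mul, dX_dT, dZ_ut, dT_u, map_sub]
    ring

theorem LaxSeq.linSeq_one {f : ℤ → Alg} (hf : LaxSeq f) :
    LinSeq (dT (qA 1) - X (.ut 0 0 0) * X (.u 1 0)) f
      (fun j => dT (f (j + 1)) - X (.ut 0 0 0) * dX (f j)) := by
  constructor <;> intro j <;>
  simp only [map_sub, ← dT_dY, ← dT_dZ, ← dX_dY, ← dX_dZ, hf.eqY, hf.eqZ, dY_q1, dZ_q1,
    Derivation.leibniz, smul_eq_mul, dX_dT, dT_u, dZ_u, dY_u, dX_u, dT_uy0, dY_ut0, dZ_ut, dX_uy,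
    dX_ut, dT_ut, add_sub_cancel_right, sub_add_cancel, rhsA, zero_add] <;>
  ring

theorem LaxSeq.linSeq_omegaOne {f : ℤ → Alg} (hf : LaxSeq f) (c : ℝ) :
    LinSeq ((2 : ℝ) • qA 1 - X (.u 0 0) * X (.u 1 0) + X .z * X (.ut 0 0 0)) f
      (fun j => ((j : ℝ) + c) • f (j + 1) - X (.u 0 0) * dX (f j) + X .z * dT (f j)) := by
  constructor <;> intro j <;>
  simp only [map_sub, map_add, Derivation.map_smul, ← dT_dY, ← dT_dZ, ← dX_dY, ← dX_dZ, hf.eqY,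
    hf.eqZ, dY_q1, dZ_q1, dX_z, dY_z, dZ_z, dT_z,
    Derivation.leibniz, smul_eq_mul, dX_dT, dT_u, dZ_u, dY_u, dX_u, dT_uy0, dY_ut0, dZ_ut, dX_uy,
    add_sub_cancel_right, sub_add_cancel, rhsA, zero_add] <;>
  simp only [Algebra.smul_def, map_add, map_sub, map_one, map_ofNat, Int.cast_sub, Int.cast_one] <;>
  ring

/-- The function `r_1 + z r_{1,z}`. -/
def wA : Alg := rA 1 + X .z * dZ (rA 1)

theorem uy_mul_dX_wA : X (.uy 0 0 0) * dX wA = 1 - X .z * uyInv * X (.uy 0 1 0) := by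
  simp only [wA, map_add, Derivation.leibniz, smul_eq_mul, dX_z, dX_dZ, dX_r1, dZ_uyInv]
  linear_combination (1 - X .z * uyInv * X (.uy 0 1 0)) * uy_mul_uyInv

theorem uy_mul_dT_wA :
    X (.uy 0 0 0) * dT wA = X (.u 0 1) * (1 - X .z * uyInv * X (.uy 0 1 0)) + X .z * X (.u 0 2) := by
  simp only [wA, map_add, Derivation.leibniz, smul_eq_mul, dT_z, dT_dZ, dT_r1, dZ_uyInv, dZ_u]
  linear_combination (X (.u 0 1) * (1 - X .z * uyInv * X (.uy 0 1 0)) + X .z * X (.u 0 2))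
    * uy_mul_uyInv

theorem LaxSeq.linSeq_omegaM1 {f : ℤ → Alg} (hf : LaxSeq f) (c : ℝ) :
    LinSeq (X (.uy 0 0 0) * wA) f
      (fun j => ((j : ℝ) + c) • f (j - 1) - X .z * dZ (f (j - 1)) + wA * dY (f j)) := by
  have hx := uy_mul_dX_wA
  have ht := uy_mul_dT_wA
  constructor <;> intro j
  · simp only [map_sub, map_add, Derivation.map_smul, ← dT_dY, ← dX_dY, hf.eqY, hf.eqZ, dX_z, dY_z,
      Derivation.leibniz, smul_eq_mul, dX_dT, dY_u, dX_u, dT_uy0, dX_uy, dY_uy, rhsA, zero_add]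
    simp only [Algebra.smul_def, map_add, map_sub, map_one, Int.cast_sub, Int.cast_one]
    linear_combination -(X (.uy 0 0 0) * dX (f (j - 1 - 1))) * hx
      + (X .z * X (.uy 0 1 0) * dX (f (j - 1 - 1))) * uy_mul_uyInv
  · simp only [map_sub, map_add, Derivation.map_smul, ← dT_dZ, ← dX_dZ, hf.eqY, hf.eqZ, dX_z, dZ_z,
      dT_z, Derivation.leibniz, smul_eq_mul, dX_dT, dT_u, dZ_u, dX_u, dT_uy0, dX_uy, dZ_uy, rhsA,
      zero_add]
    simp only [Algebra.smul_def, map_add, map_sub, map_one, Int.cast_sub, Int.cast_one]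
    linear_combination -(X (.u 0 1) * dX (f (j - 1 - 1))) * hx + dX (f (j - 1 - 1)) * ht

/-! ## The seed symmetries as derivations -/

section Values

variable {φ : Alg} {φm φp : ℤ → Alg}

theorem field_qA_int (h0 : φp 0 = φ) (hneg : ∀ n : ℕ, φp (Int.negSucc n) = 0) (j : ℤ) :
    der (fieldA φ φm φp) (qA j) = φp j := by
  rcases j with n | (_ | n)
  · exact field_qA h0 n
  · rw [hneg]; exact field_x
  · rw [hneg]; exact map_zero _

theorem field_rA_int (h0 : φm 0 = 0) (hneg : ∀ n : ℕ, φm (Int.negSucc n) = 0) (j : ℤ) :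
    der (fieldA φ φm φp) (rA j) = φm j := by
  rcases j with n | n
  · exact field_rA h0 n
  · rw [hneg]; exact map_zero _

end Values

theorem rA_negSucc (n : ℕ) : rA (Int.negSucc n) = 0 := rfl
theorem qA_negOne : qA (-1) = X .x := rfl

theorem qA_of_lt {j : ℤ} (h : j < -1) : qA j = 0 := by
  obtain ⟨n, rfl⟩ : ∃ n : ℕ, j = Int.negSucc (n + 1) := ⟨(-j - 2).toNat, by omega⟩
  rfl

theorem rA_of_neg {j : ℤ} (h : j < 0) : rA j = 0 := by
  obtain ⟨n, rfl⟩ : ∃ n : ℕ, j = Int.negSucc n := ⟨(-j - 1).toNat, by omega⟩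
  rfl

/-- `PsiM1` as a derivation. -/
def psiM1D : Derivation ℝ Alg Alg :=
  der (fieldA (-X (.u 0 1)) (fun α => -dZ (rA α)) (fun α => -dZ (qA α)))

/-- `PsiZero` as a derivation. -/
def psiZeroD : Derivation ℝ Alg Alg :=
  der (fieldA (X (.ut 0 0 0)) (fun α => dT (rA α)) (fun α => dT (qA α)))

/-- `PsiOne` as a derivation. -/
def psiOneD : Derivation ℝ Alg Alg :=
  der (fieldA (dT (qA 1) - X (.ut 0 0 0) * X (.u 1 0))
    (fun α => dT (rA (α - 1)) - X (.ut 0 0 0) * dX (rA α))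
    (fun α => dT (qA (α + 1)) - X (.ut 0 0 0) * dX (qA α)))

/-- `OmegaM1` as a derivation. -/
def omegaM1D : Derivation ℝ Alg Alg :=
  der (fieldA (X (.uy 0 0 0) * wA)
    (fun α => -((α : ℝ) + 1) • rA (α + 1) - X .z * dZ (rA (α + 1)) + wA * dY (rA α))
    (fun α => X .z * dT (qA (α - 2)) - X .z * X (.u 0 1) * dX (qA (α - 2)) + (α : ℝ) • qA (α - 1)
      + X (.uy 0 0 0) * wA * dX (qA (α - 1))))

/-- `OmegaOne` as a derivation. -/
def omegaOneD : Derivation ℝ Alg Alg :=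
  der (fieldA ((2 : ℝ) • qA 1 - X (.u 0 0) * X (.u 1 0) + X .z * X (.ut 0 0 0))
    (fun α => -((α : ℝ) - 1) • rA (α - 1) - X .z * dZ (rA (α - 1))
      + (X .z * dT (rA 1) - X (.u 0 0) * dX (rA 1)) * dY (rA (α - 1)))
    (fun α => ((α : ℝ) + 2) • qA (α + 1) - X (.u 0 0) * dX (qA α) + X .z * dT (qA α)))

theorem repField_psiM1 : RepField PsiM1 psiM1D := by
  refine RepField.der (rep_field (Rep.co _).neg (fun i => ?_) (fun i => ?_))
  · exact (Rep.act rep_Dz (Rep.r i)).neg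
  · exact (Rep.act rep_Dz (Rep.q i)).neg

theorem repField_psiZero : RepField PsiZero psiZeroD := by
  refine RepField.der (rep_field (Rep.co _) (fun i => ?_) (fun i => ?_))
  · exact Rep.act rep_Dt (Rep.r i)
  · exact Rep.act rep_Dt (Rep.q i)

theorem repField_psiOne : RepField PsiOne psiOneD := by
  refine RepField.der (rep_field ?_ (fun i => ?_) (fun i => ?_))
  · exact (Rep.act rep_Dt (Rep.q 1)).sub ((Rep.co _).mul (Rep.co _))
  · exact (Rep.act rep_Dt (Rep.r _)).sub ((Rep.co _).mul (Rep.act rep_Dx (Rep.r _)))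
  · exact (Rep.act rep_Dt (Rep.q _)).sub ((Rep.co _).mul (Rep.act rep_Dx (Rep.q _)))

theorem rep_w : Rep (r 1 + co .z * act Dz (r 1)) wA :=
  (Rep.r 1).add ((Rep.co _).mul (Rep.act rep_Dz (Rep.r 1)))

theorem repField_omegaM1 : RepField OmegaM1 omegaM1D := by
  refine RepField.der (rep_field ((Rep.co _).mul rep_w) (fun i => ?_) (fun i => ?_))
  · exact (((Rep.r _).smul _).sub ((Rep.co _).mul (Rep.act rep_Dz (Rep.r _)))).add
      (rep_w.mul (Rep.act rep_Dy (Rep.r _)))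
  · exact ((((Rep.co _).mul (Rep.act rep_Dt (Rep.q _))).sub
      (((Rep.co _).mul (Rep.co _)).mul (Rep.act rep_Dx (Rep.q _)))).add ((Rep.q _).smul _)).add
      (((Rep.co _).mul rep_w).mul (Rep.act rep_Dx (Rep.q _)))

theorem repField_omegaOne : RepField OmegaOne omegaOneD := by
  refine RepField.der (rep_field ?_ (fun i => ?_) (fun i => ?_))
  · exact (((Rep.q 1).smul _).sub ((Rep.q 0).mul (Rep.co _))).add ((Rep.co _).mul (Rep.co _))
  · exact (((Rep.r _).smul _).sub ((Rep.co _).mul (Rep.act rep_Dz (Rep.r _)))).add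
      ((((Rep.co _).mul (Rep.act rep_Dt (Rep.r _))).sub
        ((Rep.q 0).mul (Rep.act rep_Dx (Rep.r _)))).mul (Rep.act rep_Dy (Rep.r _)))
  · exact (((Rep.q _).smul _).sub ((Rep.q 0).mul (Rep.act rep_Dx (Rep.q _)))).add
      ((Rep.co _).mul (Rep.act rep_Dt (Rep.q _)))

theorem sym_psiM1D : Sym psiM1D :=
  sym_field_of_linSeq (by rw [qA_zero, dZ_u]) (by rw [rA_zero, dZ_y, neg_zero])
    laxSeq_q.linSeq_dZ laxSeq_r.linSeq_dZ

theorem sym_psiZeroD : Sym psiZeroD :=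
  sym_field_of_linSeq (dT_u 0 0) dT_y laxSeq_q.linSeq_dT laxSeq_r.linSeq_dT

theorem sym_psiOneD : Sym psiOneD := by
  refine sym_field_of_linSeq ?_ ?_ laxSeq_q.linSeq_one ?_
  · rw [zero_add, qA_zero, dX_u]
  · rw [rA_of_neg (by norm_num : (0 : ℤ) - 1 < 0), rA_zero, dX_y, map_zero, mul_zero, sub_zero]
  · convert laxSeq_r.linSeq_one using 2 with j
    simp only [rNeg, neg_add, sub_eq_add_neg]

theorem omegaOne_rA (j : ℤ) :
    -(((-j : ℤ) : ℝ) - 1) • rA (-j - 1) - X .z * dZ (rA (-j - 1))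
      + (X .z * dT (rA 1) - X (.u 0 0) * dX (rA 1)) * dY (rA (-j - 1))
    = ((j : ℝ) + 1) • rNeg (j + 1) - X (.u 0 0) * dX (rNeg j) + X .z * dT (rNeg j) := by
  rw [dZ_rA, dY_rA, dT_r1, dX_r1, rNeg, rNeg, sub_add_cancel, show -(j + 1) = -j - 1 by ring]
  have e : -(((-j : ℤ) : ℝ) - 1) = (j : ℝ) + 1 := by push_cast; ring
  rw [e]
  linear_combination ((X .z * X (.u 0 1) - X (.u 0 0)) * dX (rA (-j))) * uy_mul_uyInv

theorem sym_omegaOneD : Sym omegaOneD := by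
  refine sym_field_of_linSeq ?_ ?_ (laxSeq_q.linSeq_omegaOne 2) ?_
  · rw [zero_add, qA_zero, dX_u, dT_u, Int.cast_zero, zero_add]
  · rw [rA_of_neg (by norm_num : (0 : ℤ) - 1 < 0), map_zero, map_zero]
    simp
  · convert laxSeq_r.linSeq_omegaOne 1 using 2 with j
    exact omegaOne_rA j

theorem omegaM1_qA (j : ℤ) :
    X .z * dT (qA (j - 2)) - X .z * X (.u 0 1) * dX (qA (j - 2)) + (j : ℝ) • qA (j - 1)
      + X (.uy 0 0 0) * wA * dX (qA (j - 1))
    = ((j : ℝ) + 0) • qA (j - 1) - X .z * dZ (qA (j - 1)) + wA * dY (qA j) := by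
  rw [laxSeq_q.eqZ, laxSeq_q.eqY, sub_sub, add_zero]
  norm_num
  ring

theorem omegaM1_rA (j : ℤ) :
    -(((-j : ℤ) : ℝ) + 1) • rA (-j + 1) - X .z * dZ (rA (-j + 1)) + wA * dY (rA (-j))
    = ((j : ℝ) + (-1)) • rNeg (j - 1) - X .z * dZ (rNeg (j - 1)) + wA * dY (rNeg j) := by
  rw [rNeg, rNeg, show -(j - 1) = -j + 1 by ring]
  have e : -(((-j : ℤ) : ℝ) + 1) = (j : ℝ) + (-1) := by push_cast; ring
  rw [e]

theorem sym_omegaM1D : Sym omegaM1D := by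
  refine sym_field_of_linSeq ?_ ?_ ?_ ?_
  · rw [qA_of_lt (by norm_num : (0 : ℤ) - 2 < -1), zero_sub, qA_negOne, dX_x]
    simp
  · simp [wA, rA_zero, dY_y]
  · convert laxSeq_q.linSeq_omegaM1 0 using 2 with j
    exact omegaM1_qA j
  · convert laxSeq_r.linSeq_omegaM1 (-1) using 2 with j
    exact omegaM1_rA j

theorem psiZeroD_qA (j : ℤ) : psiZeroD (qA j) = dT (qA j) :=
  field_qA_int (φp := fun α => dT (qA α)) (dT_u 0 0) (by
    rintro (_ | n)
    · exact dT_x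
    · exact map_zero _) j

theorem psiZeroD_rA (j : ℤ) : psiZeroD (rA j) = dT (rA j) :=
  field_rA_int (φm := fun α => dT (rA α)) dT_y (fun _ => map_zero _) j

theorem psiOneD_qA (j : ℤ) :
    psiOneD (qA j) = dT (qA (j + 1)) - X (.ut 0 0 0) * dX (qA j) := by
  refine field_qA_int (φp := fun α => dT (qA (α + 1)) - X (.ut 0 0 0) * dX (qA α)) ?_ ?_ j
  · rw [zero_add, qA_zero, dX_u]
  · rintro (_ | _ | n)
    · change dT (X (.u 0 0)) - _ * dX (X .x) = 0
      rw [dT_u, dX_x, mul_one, sub_self]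
    · change dT (X .x) - _ * dX 0 = 0
      rw [dT_x, map_zero, mul_zero, sub_zero]
    · change dT 0 - _ * dX 0 = 0
      rw [map_zero, map_zero, mul_zero, sub_zero]

theorem psiM1D_rA (j : ℤ) : psiM1D (rA j) = -dZ (rA j) :=
  field_rA_int (φm := fun α => -dZ (rA α)) (by rw [rA_zero, dZ_y, neg_zero])
    (fun _ => by rw [rA_negSucc, map_zero, neg_zero]) j

theorem omegaOneD_qA (j : ℤ) :
    omegaOneD (qA j) = ((j : ℝ) + 2) • qA (j + 1) - X (.u 0 0) * dX (qA j) + X .z * dT (qA j) := by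
  refine field_qA_int
    (φp := fun α => ((α : ℝ) + 2) • qA (α + 1) - X (.u 0 0) * dX (qA α) + X .z * dT (qA α)) ?_ ?_ j
  · rw [zero_add, qA_zero, dX_u, dT_u, Int.cast_zero, zero_add]
  · intro n
    rcases n with (_ | _ | n)
    · change (((-1 : ℤ) : ℝ) + 2) • X (.u 0 0) - X (.u 0 0) * dX (X .x) + X .z * dT (X .x) = 0
      rw [dX_x, dT_x]
      norm_num
    · change (((-2 : ℤ) : ℝ) + 2) • X .x - X (.u 0 0) * dX 0 + X .z * dT 0 = 0
      norm_num
    · change _ • (0 : Alg) - X (.u 0 0) * dX 0 + X .z * dT 0 = 0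
      simp

theorem omegaM1D_rNeg (j : ℤ) :
    omegaM1D (rNeg j)
      = ((j : ℝ) + (-1)) • rNeg (j - 1) - X .z * dZ (rNeg (j - 1)) + wA * dY (rNeg j) := by
  rw [← omegaM1_rA]
  refine field_rA_int
    (φm := fun α => -((α : ℝ) + 1) • rA (α + 1) - X .z * dZ (rA (α + 1)) + wA * dY (rA α)) ?_ ?_ (-j)
  · simp [wA, rA_zero, dY_y]
  · intro n
    rcases n with (_ | n)
    · change -(((-1 : ℤ) : ℝ) + 1) • X .y - X .z * dZ (X .y) + wA * dY 0 = 0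
      rw [dZ_y]
      norm_num
    · change _ • (0 : Alg) - X .z * dZ 0 + wA * dY 0 = 0
      simp

/-! ## The recursion between neighbouring symmetries -/

theorem smul_eq_natCast_mul (n : ℕ) (a : Alg) : (n : ℝ) • a = (n : Alg) * a := by
  rw [Algebra.smul_def, map_natCast]

theorem cancel_natCast_succ {n : ℕ} {a b : Alg} (h : ((n : Alg) + 1) * a = ((n : Alg) + 1) * b) :
    a = b := by
  have e : ∀ c : Alg, ((n : Alg) + 1) * c = ((n + 1 : ℕ) : ℝ) • c := fun c => by
    rw [smul_eq_natCast_mul]; push_cast; rfl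
  rw [e, e] at h
  have hn : ((n + 1 : ℕ) : ℝ) ≠ 0 := Nat.cast_ne_zero.2 n.succ_ne_zero
  calc a = (((n + 1 : ℕ) : ℝ)⁻¹) • (((n + 1 : ℕ) : ℝ) • a) := by rw [inv_smul_smul₀ hn]
    _ = b := by rw [h, inv_smul_smul₀ hn]

/-- `PsiPos` as a derivation. -/
def psiPosD : ℕ → Derivation ℝ Alg Alg
  | 0 => psiOneD
  | n + 1 => ((n : ℝ) + 1)⁻¹ • ⁅omegaOneD, psiPosD n⁆

/-- `PsiNeg` as a derivation. -/
def psiNegD : ℕ → Derivation ℝ Alg Alg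
  | 0 => psiM1D
  | n + 1 => (-((n : ℝ) + 1))⁻¹ • ⁅omegaM1D, psiNegD n⁆

/-- `Psi0` as a derivation. -/
def psi0D : ℤ → Derivation ℝ Alg Alg
  | .ofNat 0 => psiZeroD
  | .ofNat (n + 1) => psiPosD n
  | .negSucc n => psiNegD n

theorem sym_psiPosD (n : ℕ) : Sym (psiPosD n) := by
  induction n with
  | zero => exact sym_psiOneD
  | succ n ih => exact (sym_omegaOneD.comm ih).smul _

theorem sym_psiNegD (n : ℕ) : Sym (psiNegD n) := by
  induction n with
  | zero => exact sym_psiM1D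
  | succ n ih => exact (sym_omegaM1D.comm ih).smul _

theorem sym_psi0D (i : ℤ) : Sym (psi0D i) := by
  rcases i with (_ | n) | n
  · exact sym_psiZeroD
  · exact sym_psiPosD n
  · exact sym_psiNegD n

theorem repField_psiPos (n : ℕ) : RepField (PsiPos n) (psiPosD n) := by
  induction n with
  | zero => exact repField_psiOne
  | succ n ih => exact (repField_omegaOne.comm ih).smul _

theorem repField_psiNeg (n : ℕ) : RepField (PsiNeg n) (psiNegD n) := by
  induction n with
  | zero => exact repField_psiM1
  | succ n ih => exact (repField_omegaM1.comm ih).smul _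

theorem repField_psi0 (i : ℤ) : RepField (Psi0 i) (psi0D i) := by
  rcases i with (_ | n) | n
  · exact repField_psiZero
  · exact repField_psiPos n
  · exact repField_psiNeg n

theorem psi0D_succ_succ (n : ℕ) (a : Alg) :
    ((n : Alg) + 1) * psi0D (n + 2 : ℕ) a
      = omegaOneD (psi0D (n + 1 : ℕ) a) - psi0D (n + 1 : ℕ) (omegaOneD a) := by
  change ((n : Alg) + 1) * ((((n : ℝ) + 1)⁻¹ • ⁅omegaOneD, psiPosD n⁆) a) = ⁅omegaOneD, psiPosD n⁆ a
  have hn : (n : ℝ) + 1 ≠ 0 := n.cast_add_one_ne_zero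
  rw [Derivation.smul_apply, mul_smul_comm,
    show (n : Alg) + 1 = algebraMap ℝ Alg ((n : ℝ) + 1) by simp, ← Algebra.smul_def,
    inv_smul_smul₀ hn]

theorem psi0D_neg_succ_succ (n : ℕ) (a : Alg) :
    -(((n : Alg) + 1) * psi0D (-(n + 2 : ℕ)) a)
      = omegaM1D (psi0D (-(n + 1 : ℕ)) a) - psi0D (-(n + 1 : ℕ)) (omegaM1D a) := by
  change -(((n : Alg) + 1) * (((-((n : ℝ) + 1))⁻¹ • ⁅omegaM1D, psiNegD n⁆) a))
    = ⁅omegaM1D, psiNegD n⁆ a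
  have hn : (n : ℝ) + 1 ≠ 0 := n.cast_add_one_ne_zero
  rw [Derivation.smul_apply, mul_smul_comm,
    show (n : Alg) + 1 = algebraMap ℝ Alg ((n : ℝ) + 1) by simp, ← Algebra.smul_def,
    inv_neg, neg_smul, neg_neg, inv_smul_smul₀ hn]

theorem psiZeroD_u : psiZeroD (X (.u 0 0)) = X (.ut 0 0 0) := (psiZeroD_qA 0).trans (dT_u 0 0)

theorem omegaOneD_comm_psiZeroD (j : ℤ) :
    omegaOneD (psiZeroD (qA j)) = psiZeroD (omegaOneD (qA j)) := by
  have h := sym_psiZeroD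
  rw [psiZeroD_qA, sym_omegaOneD.cT, omegaOneD_qA]
  simp only [map_sub, map_add, Derivation.map_smul, Derivation.leibniz, smul_eq_mul, h.cX, h.cT,
    h.z, psiZeroD_qA, psiZeroD_u, dT_u, dT_z, dX_dT]

theorem omegaM1D_comm_psiZeroD (j : ℤ) :
    omegaM1D (psiZeroD (rNeg j)) = psiZeroD (omegaM1D (rNeg j)) := by
  have h := sym_psiZeroD
  have hr : ∀ j, psiZeroD (rNeg j) = dT (rNeg j) := fun j => psiZeroD_rA (-j)
  rw [hr, sym_omegaM1D.cT, omegaM1D_rNeg]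
  simp only [map_sub, map_add, Derivation.map_smul, Derivation.leibniz, smul_eq_mul, h.cY, h.cZ,
    h.z, hr, psiZeroD_rA, wA, dT_dY, dT_dZ, dT_z]

/-- On the positive covering, `δ_i q = λ χ_i q_x + λ δ_{i+1} q` for `i ≥ 0`. -/
theorem psi0D_qA (n : ℕ) : ∀ j : ℤ, psi0D n (qA j)
    = psi0D n (X (.u 0 0)) * dX (qA (j - 1)) + psi0D (n + 1 : ℕ) (qA (j - 1)) := by
  induction n with
  | zero =>
    intro j
    change psiZeroD _ = psiZeroD _ * _ + psiOneD _
    rw [psiZeroD_qA, psiZeroD_u, psiOneD_qA, sub_add_cancel]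
    ring
  | succ n ih =>
    have hcom : ∀ j, omegaOneD (psi0D n (qA j)) - psi0D n (omegaOneD (qA j))
        = (n : Alg) * psi0D (n + 1 : ℕ) (qA j) := by
      intro j
      cases n with
      | zero =>
        change omegaOneD (psiZeroD _) - psiZeroD _ = _
        rw [omegaOneD_comm_psiZeroD, sub_self, Nat.cast_zero, zero_mul]
      | succ n =>
        rw [← psi0D_succ_succ n, Nat.cast_succ (R := Alg) n]
    set P := psi0D n with hP
    set P' := psi0D (n + 1 : ℕ) with hP'
    set P'' := psi0D (n + 1 + 1 : ℕ) with hP''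
    have hs : Sym P := sym_psi0D _
    have hs' : Sym P' := sym_psi0D _
    set χ := P (X (.u 0 0)) with hχ
    have ihj : ∀ j, P' (qA j) = P (qA (j + 1)) - χ * dX (qA j) := fun j => by
      rw [ih (j + 1), add_sub_cancel_right]; ring
    set C := -X (.u 0 0) * dX χ + X .z * dT χ - omegaOneD χ + P' (X (.u 0 0)) + χ * X (.u 1 0)
      with hC
    have key : ∀ j : ℤ, ((n : Alg) + 1) * P'' (qA j)
        = ((n : Alg) + 1) * P' (qA (j + 1)) + C * dX (qA j) := by
      intro j
      rw [hP'', psi0D_succ_succ n (qA j), ← hP', ihj j, map_sub, Derivation.leibniz,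
        sym_omegaOneD.cX, eq_add_of_sub_eq (hcom (j + 1)), omegaOneD_qA, omegaOneD_qA]
      simp only [map_sub, map_add, Derivation.map_smul, Derivation.leibniz, smul_eq_mul, hs.cX,
        hs.cT, hs.z, hs'.cX, hs'.cT, hs'.z, dX_u, dX_z, zero_add]
      rw [ih (j + 1 + 1), ih (j + 1)]
      simp only [map_add, Derivation.leibniz, smul_eq_mul, add_sub_cancel_right, dX_dT,
        Algebra.smul_def, map_intCast, map_ofNat, map_one, Int.cast_add, Int.cast_one]
      ring
    have hCval : C = -(((n : Alg) + 1) * P' (X (.u 0 0))) := by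
      have h1 : P'' (X .x) = 0 := (sym_psi0D _).x
      have h := key (-1)
      rw [qA_negOne, h1, dX_x, neg_add_cancel, qA_zero] at h
      linear_combination -h
    intro j
    have h := key (j - 1)
    rw [hCval, sub_add_cancel] at h
    refine cancel_natCast_succ (n := n) ?_
    linear_combination -h

theorem rNeg_zero : rNeg 0 = X .y := rfl
theorem rNeg_negOne : rNeg (-1) = rA 1 := rfl

/-- On the negative covering, `δ_i r = λ χ_i r_x + λ δ_{i+1} r` for `i < 0`. -/
theorem psi0D_rNeg (n : ℕ) : ∀ j : ℤ, psi0D (-(n + 1 : ℕ)) (rNeg j)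
    = psi0D (-(n + 1 : ℕ)) (X (.u 0 0)) * dX (rNeg (j - 1)) + psi0D (-(n : ℕ)) (rNeg (j - 1)) := by
  induction n with
  | zero =>
    intro j
    change psiM1D (rA (-j)) = psiM1D _ * _ + psiZeroD (rA (-(j - 1)))
    have hu : psiM1D (X (.u 0 0)) = -X (.u 0 1) := field_u 0 0
    rw [psiM1D_rA, hu, psiZeroD_rA]
    have := laxSeq_r.eqZ j
    rw [rNeg, rNeg] at this
    rw [this, rNeg]
    ring
  | succ n ih =>
    have hcom : ∀ j, omegaM1D (psi0D (-(n : ℕ)) (rNeg j)) - psi0D (-(n : ℕ)) (omegaM1D (rNeg j))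
        = -((n : Alg) * psi0D (-(n + 1 : ℕ)) (rNeg j)) := by
      intro j
      cases n with
      | zero =>
        change omegaM1D (psiZeroD _) - psiZeroD _ = _
        rw [omegaM1D_comm_psiZeroD, sub_self, Nat.cast_zero, zero_mul, neg_zero]
      | succ n =>
        rw [← psi0D_neg_succ_succ n, Nat.cast_succ (R := Alg) n]
    set P := psi0D (-(n : ℕ)) with hP
    set P' := psi0D (-(n + 1 : ℕ)) with hP'
    set P'' := psi0D (-(n + 1 + 1 : ℕ)) with hP''
    have hs : Sym P := sym_psi0D _
    have hs' : Sym P' := sym_psi0D _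
    set χ := P' (X (.u 0 0)) with hχ
    have hr1 : P (rA 1) = -(χ * uyInv) := by
      have h := ih 0
      rw [zero_sub, rNeg_zero, rNeg_negOne, hs'.y, dX_r1] at h
      linear_combination -h
    have hPw : X (.uy 0 0 0) * P wA = -χ - X .z * dZ χ + X .z * χ * uyInv * X (.uy 0 1 0) := by
      simp only [wA, map_add, Derivation.leibniz, smul_eq_mul, hs.cZ, hs.z, hr1, map_neg, dZ_uyInv]
      linear_combination (-χ - X .z * dZ χ + X .z * χ * uyInv * X (.uy 0 1 0)) * uy_mul_uyInv
    have huy : P' (X (.uy 0 0 0)) = dY χ := by rw [← dY_u, hs'.cY]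
    have hΩu : omegaM1D (X (.u 0 0)) = X (.uy 0 0 0) * wA := field_u 0 0
    have hu : -(((n : Alg) + 1) * P'' (X (.u 0 0)))
        = omegaM1D χ - wA * dY χ - X (.uy 0 0 0) * P' wA := by
      rw [hP'', psi0D_neg_succ_succ n, ← hP', hΩu, Derivation.leibniz, huy, smul_eq_mul, smul_eq_mul]
      ring
    intro j
    refine cancel_natCast_succ (n := n) ?_
    have h := psi0D_neg_succ_succ n (rNeg j)
    rw [← hP', ih j, map_add, Derivation.leibniz,
      sym_omegaM1D.cX, eq_add_of_sub_eq (hcom (j - 1)), omegaM1D_rNeg, omegaM1D_rNeg] at h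
    simp only [map_sub, map_add, Derivation.map_smul, Derivation.leibniz, smul_eq_mul, hs.cY,
        hs.cZ, hs.z, hs'.cY, hs'.cZ, hs'.z, dX_z] at h
    rw [ih j, ih (j - 1)] at h
    rw [ih (j - 1)]
    simp only [map_add, map_sub, Derivation.leibniz, smul_eq_mul, ← dX_dY, ← dX_dZ, laxSeq_r.eqY,
      Algebra.smul_def, map_intCast, map_neg, map_one, Int.cast_sub, Int.cast_one] at h ⊢
    linear_combination -h + dX (rNeg (j - 1)) * hu - dX (rNeg (j - 1 - 1)) * hPw
      - χ * dX (rNeg (j - 1 - 1)) * uy_mul_dX_wA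

/-! ## Two-sided sequences of shadows and their lifts -/

/-- The coefficients of a formal Laurent series `χ` for which `χ ∂_x` commutes with the Lax pair. -/
structure ShadowSeq (χ : ℤ → Alg) : Prop where
  eqY : ∀ i, dY (χ (i + 1)) = X (.uy 0 0 0) * dX (χ i) - X (.uy 1 0 0) * χ i
  eqZ : ∀ i, dZ (χ (i + 1)) = X (.u 0 1) * dX (χ i) - X (.u 1 1) * χ i - dT (χ i)

theorem Sym.apply_uy {S : Derivation ℝ Alg Alg} (hS : Sym S) :
    S (X (.uy 0 0 0)) = dY (S (X (.u 0 0))) := by rw [← dY_u, hS.cY]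

theorem Sym.apply_uz {S : Derivation ℝ Alg Alg} (hS : Sym S) :
    S (X (.u 0 1)) = dZ (S (X (.u 0 0))) := by rw [← dZ_u, hS.cZ]

theorem Sym.apply_ux {S : Derivation ℝ Alg Alg} (hS : Sym S) :
    S (X (.u 1 0)) = dX (S (X (.u 0 0))) := by rw [← dX_u, hS.cX]

theorem Sym.apply_ut {S : Derivation ℝ Alg Alg} (hS : Sym S) :
    S (X (.ut 0 0 0)) = dT (S (X (.u 0 0))) := by rw [← dT_u, hS.cT]

theorem shadowSeq_psi0D : ShadowSeq (fun i => psi0D i (X (.u 0 0))) := by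
  have hpos : ∀ n : ℕ, psi0D (n + 1) (X (.u 0 0))
      = psi0D n (qA 1) - psi0D n (X (.u 0 0)) * X (.u 1 0) := by
    intro n
    have h := psi0D_qA n 1
    rw [sub_self, qA_zero, dX_u, Nat.cast_succ] at h
    linear_combination -h
  have hneg : ∀ n : ℕ, psi0D (Int.negSucc n + 1) (rA 1)
      = -(psi0D (Int.negSucc n) (X (.u 0 0)) * uyInv) := by
    intro n
    have h := psi0D_rNeg n 0
    rw [zero_sub, rNeg_zero, rNeg_negOne, (sym_psi0D _).y, dX_r1] at h
    rw [show Int.negSucc n + 1 = -(n : ℤ) by omega, show Int.negSucc n = -((n + 1 : ℕ) : ℤ) from rfl]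
    linear_combination -h
  have hYneg : ∀ n : ℕ, dY (psi0D (Int.negSucc n + 1) (X (.u 0 0)))
      = X (.uy 0 0 0) * dX (psi0D (Int.negSucc n) (X (.u 0 0)))
        - X (.uy 1 0 0) * psi0D (Int.negSucc n) (X (.u 0 0)) := by
    intro n
    have hs := sym_psi0D (Int.negSucc n + 1)
    have h := hs.cX (rA 1)
    rw [dX_r1, hneg, derivation_uyInv, hs.apply_uy, map_neg, Derivation.leibniz, dX_uyInv] at h
    simp only [smul_eq_mul] at h
    generalize psi0D (Int.negSucc n) (X (.u 0 0)) = χ at h ⊢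
    generalize psi0D (Int.negSucc n + 1) (X (.u 0 0)) = χ' at h ⊢
    linear_combination -X (.uy 0 0 0) ^ 2 * h + (X (.uy 0 0 0) * dX χ
      - (X (.uy 0 0 0) * uyInv + 1) * (dY χ' + X (.uy 1 0 0) * χ)) * uy_mul_uyInv
  refine ⟨fun i => ?_, fun i => ?_⟩ <;> rcases i with n | n
  · have hs := sym_psi0D n
    simp only [Int.ofNat_eq_natCast]
    rw [hpos, map_sub, ← hs.cY, dY_q1]
    simp only [Derivation.leibniz, smul_eq_mul, hs.apply_uy, hs.apply_ux]
    rw [← dX_u, ← dX_dY, dY_u, dX_uy]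
    ring
  · exact hYneg n
  · have hs := sym_psi0D n
    simp only [Int.ofNat_eq_natCast]
    rw [hpos, map_sub, ← hs.cZ, dZ_q1]
    simp only [Derivation.leibniz, smul_eq_mul, hs.apply_uz, hs.apply_ux, hs.apply_ut, map_sub]
    rw [← dX_u, ← dX_dZ, dZ_u]
    simp only [dX_u, zero_add]
    ring
  · have hs := sym_psi0D (Int.negSucc n + 1)
    have h := hs.cT (rA 1)
    rw [dT_r1, hneg, Derivation.leibniz, derivation_uyInv, hs.apply_uy, hs.apply_uz, map_neg,
      Derivation.leibniz, dT_uyInv] at h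
    simp only [smul_eq_mul, rhsA] at h
    have hY := hYneg n
    generalize psi0D (Int.negSucc n) (X (.u 0 0)) = χ at h hY ⊢
    generalize psi0D (Int.negSucc n + 1) (X (.u 0 0)) = χ' at h hY ⊢
    linear_combination X (.uy 0 0 0) * h + X (.u 0 1) * uyInv * hY + (X (.u 0 1) * dX χ - dZ χ'
      - dT χ - (X (.uy 0 0 0) * uyInv + 1) * X (.u 1 1) * χ
      + X (.u 0 1) * uyInv * (dY χ' + X (.uy 1 0 0) * χ)) * uy_mul_uyInv

/-- The generating functions at `q_n` of the lift of `χ i`. -/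
def liftQ (χ : ℤ → Alg) : ℕ → ℤ → Alg
  | 0, i => χ i
  | n + 1, i => χ i * dX (qA n) + liftQ χ n (i + 1)

/-- The generating functions at `r_n` of the lift of `χ i`. -/
def liftR (χ : ℤ → Alg) : ℕ → ℤ → Alg
  | 0, _ => 0
  | n + 1, i => liftR χ n (i - 1) - χ (i - 1) * dX (rA (n + 1))

theorem liftR_succ (χ : ℤ → Alg) (n : ℕ) (i : ℤ) :
    liftR χ (n + 1) i = liftR χ n (i - 1) - χ (i - 1) * dX (rA (n + 1)) := rfl

namespace ShadowSeq

variable {χ : ℤ → Alg} (h : ShadowSeq χ)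

/-- The lift of `χ i` to a symmetry. -/
def lift (χ : ℤ → Alg) (i : ℤ) : Derivation ℝ Alg Alg :=
  der (fieldA (χ i) (fun α => liftR χ α.toNat i) (fun α => liftQ χ α.toNat i))

include h

theorem dY_liftQ (n : ℕ) (i : ℤ) : dY (liftQ χ (n + 1) i)
    = dY (χ i) * dX (qA n) + X (.uy 0 0 0) * dX (liftQ χ n i) := by
  induction n generalizing i with
  | zero =>
    simp only [liftQ, Nat.cast_zero, qA_zero, map_add, h.eqY, Derivation.leibniz, smul_eq_mul]
    rw [← dX_dY, dY_u, dX_u, dX_uy]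
    ring
  | succ n ih =>
    rw [liftQ, map_add, ih, liftQ, h.eqY]
    simp only [Nat.cast_succ, map_add, Derivation.leibniz, smul_eq_mul, ← dX_dY, dY_qA_succ, dX_uy]
    ring

theorem dZ_liftQ (n : ℕ) (i : ℤ) : dZ (liftQ χ (n + 1) i)
    = dZ (χ i) * dX (qA n) + X (.u 0 1) * dX (liftQ χ n i) - dT (liftQ χ n i) := by
  induction n generalizing i with
  | zero =>
    simp only [liftQ, Nat.cast_zero, qA_zero, map_add, h.eqZ, Derivation.leibniz, smul_eq_mul]
    rw [← dX_dZ, dZ_u, dX_u, dX_u]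
    ring
  | succ n ih =>
    rw [liftQ, map_add, ih, liftQ, h.eqZ]
    simp only [Nat.cast_succ, map_add, map_sub, Derivation.leibniz, smul_eq_mul, ← dX_dZ, dZ_qA_succ,
      dX_u, dX_dT]
    ring

theorem dY_liftR (n : ℕ) (i : ℤ) : dY (liftR χ n i)
    = dY (χ i) * dX (rA (n + 1)) + X (.uy 0 0 0) * dX (liftR χ (n + 1) i) := by
  have hi : ∀ i, dY (χ i) = X (.uy 0 0 0) * dX (χ (i - 1)) - X (.uy 1 0 0) * χ (i - 1) := by
    intro i
    rw [← h.eqY, sub_add_cancel]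
  induction n generalizing i with
  | zero =>
    simp only [liftR, hi, Nat.cast_zero, zero_add, dX_r1, map_zero, map_sub, Derivation.leibniz,
      smul_eq_mul, dX_uyInv]
    linear_combination (-X (.uy 1 0 0) * χ (i - 1) * uyInv) * uy_mul_uyInv
  | succ n ih =>
    rw [liftR_succ, liftR_succ, map_sub, ih, hi i]
    simp only [Nat.cast_succ, map_sub, Derivation.leibniz, smul_eq_mul, ← dX_dY, dY_rA, dX_uy]
    ring

theorem dZ_liftR (n : ℕ) (i : ℤ) : dZ (liftR χ n i)
    = dZ (χ i) * dX (rA (n + 1)) + X (.u 0 1) * dX (liftR χ (n + 1) i)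
      - dT (liftR χ (n + 1) i) := by
  have hi : ∀ i, dZ (χ i) = X (.u 0 1) * dX (χ (i - 1)) - X (.u 1 1) * χ (i - 1) - dT (χ (i - 1)) := by
    intro i
    rw [← h.eqZ, sub_add_cancel]
  induction n generalizing i with
  | zero =>
    simp only [liftR, hi, Nat.cast_zero, zero_add, dX_r1, map_zero, map_sub, Derivation.leibniz,
      smul_eq_mul, dX_uyInv, dT_uyInv, rhsA]
    linear_combination (-X (.u 1 1) * χ (i - 1) * uyInv) * uy_mul_uyInv
  | succ n ih =>
    rw [liftR_succ, liftR_succ, map_sub, ih, hi i]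
    simp only [Nat.cast_succ, map_sub, Derivation.leibniz, smul_eq_mul, ← dX_dZ, dZ_rA, dX_u, dX_dT]
    ring

theorem sym_lift (i : ℤ) : Sym (lift χ i) := by
  refine sym_field rfl rfl (fun n => ?_) (fun n => ?_) (fun n => ?_) (fun n => ?_)
  · exact h.dY_liftQ n i
  · exact h.dZ_liftQ n i
  · exact h.dY_liftR n i
  · exact h.dZ_liftR n i

/-- Multiplication by `t - λ z`. -/
theorem mul_t_sub : ShadowSeq (fun i => X .t * χ i - X .z * χ (i - 1)) := by
  constructor <;> intro i
  · have h1 := h.eqY i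
    have h2 := h.eqY (i - 1)
    simp only [map_sub, Derivation.leibniz, smul_eq_mul, dY_t, dY_z, dX_t, dX_z,
      add_sub_cancel_right, sub_add_cancel] at h2 ⊢
    linear_combination X .t * h1 - X .z * h2
  · have h1 := h.eqZ i
    have h2 := h.eqZ (i - 1)
    simp only [map_sub, Derivation.leibniz, smul_eq_mul, dZ_t, dZ_z, dX_t, dX_z, dT_t, dT_z,
      add_sub_cancel_right, sub_add_cancel] at h2 ⊢
    linear_combination X .t * h1 - X .z * h2

end ShadowSeq

theorem lift_u (χ : ℤ → Alg) (i : ℤ) : ShadowSeq.lift χ i (X (.u 0 0)) = χ i := field_u 0 0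

/-! ## The hierarchies -/

/-- `psi` in the algebra. -/
def psiA (j : ℕ) (i : ℤ) : Alg :=
  ∑ m ∈ Finset.range (j + 1),
    ((-1 : ℝ) ^ m * (j.choose m : ℝ)) •
      (X .t ^ (j - m) * X .z ^ m * psi0D (i - m) (X (.u 0 0)))

theorem rep_psi (j : ℕ) (i : ℤ) : Rep (psi j i) (psiA j i) :=
  Rep.sum _ fun m => ((((Rep.co .t).pow _).mul ((Rep.co .z).pow _)).mul
    (repField_psi0 (i - m) (.u 0 0))).smul _

theorem psiA_zero (i : ℤ) : psiA 0 i = psi0D i (X (.u 0 0)) := by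
  simp [psiA]

theorem psiA_succ (j : ℕ) (i : ℤ) : psiA (j + 1) i = X .t * psiA j i - X .z * psiA j (i - 1) := by
  set F : ℕ → ℕ → Alg := fun m k =>
    (-1) ^ m * (X .t ^ k * X .z ^ m * psi0D (i - m) (X (.u 0 0))) with hF
  have e : ∀ (j m k : ℕ) (a : Alg), ((-1 : ℝ) ^ m * (j.choose m : ℝ)) • a
      = (j.choose m : Alg) * ((-1) ^ m * a) := by
    intro j m k a
    rw [Algebra.smul_def, map_mul, map_pow, map_neg, map_one, map_natCast]
    ring
  have h := Finset.sum_choose_succ_mul F j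
  simp only [psiA, e _ _ 0]
  refine h.trans ?_
  rw [sub_eq_add_neg, Finset.mul_sum, ← neg_mul, Finset.mul_sum]
  congr 1
  · refine Finset.sum_congr rfl fun m hm => ?_
    have hmj : j + 1 - m = j - m + 1 := by
      have := Finset.mem_range.1 hm
      omega
    rw [hF, hmj]
    ring
  · refine Finset.sum_congr rfl fun m _ => ?_
    rw [hF]
    dsimp only
    rw [show i - ((m + 1 : ℕ) : ℤ) = i - 1 - m by push_cast; ring]
    ring

theorem shadowSeq_psiA (j : ℕ) : ShadowSeq (psiA j) := by
  induction j with
  | zero =>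
    rw [show psiA 0 = fun i => psi0D i (X (.u 0 0)) from funext psiA_zero]
    exact shadowSeq_psi0D
  | succ j ih =>
    rw [show psiA (j + 1) = _ from funext (psiA_succ j)]
    exact ih.mul_t_sub

theorem repField_ext0 (S : Derivation ℝ Alg Alg) : RepField (fun c => ext0 (S (X c))) S :=
  fun c p => ext0_apply (S (X c)) p

/-- The lifts of `psi j i`. -/
def psiLift : ℕ → ℤ → VField
  | 0, i => Psi0 i
  | j + 1, i => fun c => ext0 (ShadowSeq.lift (psiA (j + 1)) i (X c))

theorem isLift_psiLift (j : ℕ) (i : ℤ) : IsLift (psiLift j i) (psi j i) := by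
  cases j with
  | zero =>
    refine (repField_psi0 i).isLift (sym_psi0D i) ?_
    rw [← psiA_zero]
    exact rep_psi 0 i
  | succ j =>
    refine (repField_ext0 _).isLift ((shadowSeq_psiA (j + 1)).sym_lift i) ?_
    rw [lift_u]
    exact rep_psi (j + 1) i

theorem isShadow_psi (j : ℕ) (i : ℤ) : IsShadow (psi j i) := by
  refine isShadow_of_sym ((shadowSeq_psiA j).sym_lift i) ?_
  rw [lift_u]
  exact rep_psi j i

theorem psi_apply_of_z_eq_zero (j : ℕ) (i : ℤ) (p : Pt) (hp : p .z = 0) :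
    psi j i p = p .t ^ j * Psi0 i (.u 0 0) p := by
  rw [psi, Finset.sum_apply, Finset.sum_range_succ', Finset.sum_eq_zero]
  · simp [co]
  · intro m _
    simp [co, hp]

theorem exists_psi_ne {j j' : ℕ} (h : j ≠ j') : ∃ i : ℤ, ¬ SameOn (psi j i) (psi j' i) := by
  classical
  refine ⟨0, fun hs => h ?_⟩
  let p : Pt := fun c => match c with
    | .t => 2
    | .ut _ _ _ => 1
    | .uy _ _ _ => 1
    | _ => 0
  have hp := hs p (show (1 : ℝ) ≠ 0 from one_ne_zero)
  have hu : Psi0 0 (.u 0 0) p = 1 := rfl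
  rw [psi_apply_of_z_eq_zero j 0 p rfl, psi_apply_of_z_eq_zero j' 0 p rfl, hu, mul_one, mul_one]
    at hp
  exact pow_right_injective₀ (a := (2 : ℝ)) two_pos (by norm_num) hp

end

end MASh

theorem theorem1 :
    (∀ (j : ℕ) (i : ℤ), MASh.IsShadow (MASh.psi j i)) ∧
    (∀ j j' : ℕ, j ≠ j' → ∃ i : ℤ, ¬ MASh.SameOn (MASh.psi j i) (MASh.psi j' i)) ∧
    ∃ Ψ : ℕ → ℤ → MASh.VField,
      (∀ i : ℤ, Ψ 0 i = MASh.Psi0 i) ∧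
      (∀ (j : ℕ) (i : ℤ), MASh.IsLift (Ψ j i) (MASh.psi j i)) :=
  ⟨MASh.isShadow_psi, fun _ _ h => MASh.exists_psi_ne h, MASh.psiLift, fun _ => rfl,
    MASh.isLift_psiLift⟩
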